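/- Let $\Bbbk$ be a commutative ring. For $r\ge 0$ let $\mathrm{AH}_r$ be the degenerate affine Hecke algebra over $\Bbbk$: the associative algebra generated by $x_1,\dots,x_r$ and the elements of the symmetric group $S_r$, subject to the relations that the elements of $S_r$ multiply as in the group algebra, that the $x_i$ commute with each other, and that $s_ix_i=x_{i+1}s_i+1$, $x_is_i=s_ix_{i+1}+1$, and $x_ls_i=s_ix_l$ for $l\ne i,i+1$, where $s_i=(i\;i{+}1)$. For a composition $\lambda$ of $r$ (zero parts allowed) let $S_\lambda\le S_r$ be the parabolic subgroup and let $M(\lambda)=m_\lambda\Bbbk S_r$ be the permutation right module $\Bbbk\otimes_{\Bbbk S_\lambda}\Bbbk S_r$. The degenerate affine Schur category $\mathbf{ASchur}$ has as objects all compositions. Its morphisms $\mu\to\lambda$ are the right $\mathrm{AH}_r$-module homomorphisms $M(\mu)\otimes_{\Bbbk S_r}\mathrm{AH}_r\to M(\lambda)\otimes_{\Bbbk S_r}\mathrm{AH}_r$ if $\lambda$ and $\mu$ are compositions of the same number $r$, and only $0$ otherwise. The tensor product $*$ is concatenation on objects and is given by the induction product for $\mathrm{AH}_a\otimes\mathrm{AH}_b\to\mathrm{AH}_{a+b}$,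 $x_i\otimes 1\mapsto x_i$, $s_i\otimes 1\mapsto s_i$, $1\otimes x_j\mapsto x_{a+j}$, $1\otimes s_j\mapsto s_{a+j}$, on morphisms. For $a,b\ge 0$ let $\mathrm{merge}\colon(a,b)\to(a+b)$ be the morphism with $m_{(a,b)}\otimes 1\mapsto m_{(a+b)}\otimes 1$, and let $\mathrm{split}\colon(a+b)\to(a,b)$ be the morphism with $m_{(a+b)}\otimes 1\mapsto\sum_y m_{(a,b)}\otimes y$, the sum being over the minimal length representatives $y$ of the cosets $(S_a\times S_b)\backslash S_{a+b}$. For a symmetric polynomial $f\in\Bbbk[x_1,\dots,x_r]^{S_r}$ let $\mathrm{pin}_r(f)\colon(r)\to(r)$ be the morphism with $m_{(r)}\otimes 1\mapsto m_{(r)}\otimes f$. Extend $\mathrm{pin}_r$, composition and $*$ coefficientwise to formal Laurent series in $u^{-1}$, and put $$e_r(u)=\prod_{j=1}^r(u-x_j),\qquad h_r(u)=e_r(u)^{-1}=\prod_{j=1}^r\frac1{u-x_j},$$ both being $1$ for $r=0$. **Theorem.** For all $a,b\ge 0$ the following hold in $\mathbf{ASchur}((u^{-1}))$: 1. $\displaystyle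 \mathrm{merge}\circ\bigl(\mathrm{pin}_a(h_a(u))*\mathrm{id}_{(b)}\bigr)\circ\mathrm{split}=\frac1{a!}\sum_{i=0}^a(-1)^{a-i}\binom ai\,\mathrm{pin}_{a+b}(e_{a+b}(u+i))\circ\mathrm{pin}_{a+b}(h_{a+b}(u));$ 2. $\displaystyle \mathrm{merge}\circ\bigl(\mathrm{id}_{(a)}*\mathrm{pin}_b(h_b(u))\bigr)\circ\mathrm{split}=\frac1{b!}\sum_{i=0}^b(-1)^{i}\binom bi\,\mathrm{pin}_{a+b}(e_{a+b}(u-i))\circ\mathrm{pin}_{a+b}(h_{a+b}(u)).$ The division by factorials is understood integrally. In (1), the Laurent series $\sum_{i=0}^a(-1)^{a-i}\binom ai e_{a+b}(u+i)h_{a+b}(u)$ with coefficients in $\mathbb Z[x_1,\dots,x_{a+b}]^{S_{a+b}}$ equals $a!\,G$ for a unique such series $G$ over $\mathbb Z$. The left hand side of (1) is the image under $\mathrm{pin}_{a+b}$ of the base change of $G$ to $\Bbbk$, and in particular the identity obtained from (1) by multiplying both sides by $a!$ holds over $\Bbbk$. The same applies to (2), with $b!$ and the sum on its right hand side. -/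

import Mathlib

open MvPolynomial

universe u

namespace DegAffSchur

/-! ### The degenerate affine Hecke algebra -/

/-- Every predicate on permutations which holds for `1` and for the basic transpositions and is
closed under products holds for all permutations. -/
theorem perm_induction {r : ℕ} (P : Equiv.Perm (Fin r) → Prop) (h1 : P 1)
    (hmul : ∀ v w, P v → P w → P (v * w))
    (hs : ∀ i j : Fin r, (i : ℕ) + 1 = j → P (Equiv.swap i j)) (w : Equiv.Perm (Fin r)) : P w := by
  cases r with
  | zero => rwa [Subsingleton.elim w 1]
  | succ n =>
    have hw : w ∈ Submonoid.closure
        (Set.range fun i : Fin n => Equiv.swap i.castSucc i.succ) := by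
      rw [Equiv.Perm.mclosure_swap_castSucc_succ]; trivial
    induction hw using Submonoid.closure_induction with
    | mem x hx => obtain ⟨i, rfl⟩ := hx; exact hs _ _ (by simp)
    | one => exact h1
    | mul x y _ _ hx hy => exact hmul _ _ hx hy

/-- Generators of the degenerate affine Hecke algebra: the polynomial generators `x_i` and the
elements of the symmetric group. -/
inductive HeckeGen (r : ℕ) : Type
  | x : Fin r → HeckeGen r
  | t : Equiv.Perm (Fin r) → HeckeGen r

/-- Defining relations of the degenerate affine Hecke algebra. The first two say that the
elements of the symmetric group multiply as they do in the group algebra. In the mixed relations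
`j = i + 1` and `swap i j` is the basic transposition `s_i`. -/
inductive HeckeRel (k : Type u) [CommRing k] (r : ℕ) :
    FreeAlgebra k (HeckeGen r) → FreeAlgebra k (HeckeGen r) → Prop
  | t_one : HeckeRel k r (FreeAlgebra.ι k (.t 1)) 1
  | t_mul (v w : Equiv.Perm (Fin r)) :
      HeckeRel k r (FreeAlgebra.ι k (.t (v * w)))
        (FreeAlgebra.ι k (.t v) * FreeAlgebra.ι k (.t w))
  | x_comm (i j : Fin r) :
      HeckeRel k r (FreeAlgebra.ι k (.x i) * FreeAlgebra.ι k (.x j))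
        (FreeAlgebra.ι k (.x j) * FreeAlgebra.ι k (.x i))
  | s_x (i j : Fin r) (h : (i : ℕ) + 1 = j) :
      HeckeRel k r (FreeAlgebra.ι k (.t (Equiv.swap i j)) * FreeAlgebra.ι k (.x i))
        (FreeAlgebra.ι k (.x j) * FreeAlgebra.ι k (.t (Equiv.swap i j)) + 1)
  | x_s (i j : Fin r) (h : (i : ℕ) + 1 = j) :
      HeckeRel k r (FreeAlgebra.ι k (.x i) * FreeAlgebra.ι k (.t (Equiv.swap i j)))
        (FreeAlgebra.ι k (.t (Equiv.swap i j)) * FreeAlgebra.ι k (.x j) + 1)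
  | x_s_far (l i j : Fin r) (h : (i : ℕ) + 1 = j) (hi : l ≠ i) (hj : l ≠ j) :
      HeckeRel k r (FreeAlgebra.ι k (.x l) * FreeAlgebra.ι k (.t (Equiv.swap i j)))
        (FreeAlgebra.ι k (.t (Equiv.swap i j)) * FreeAlgebra.ι k (.x l))

/-- The degenerate affine Hecke algebra of rank `r` over `k`. -/
abbrev AH (k : Type u) [CommRing k] (r : ℕ) : Type u := RingQuot (HeckeRel k r)

section Hecke

variable (k : Type u) [CommRing k]

/-- The generator `x_i`. -/
noncomputable def xgen {r : ℕ} (i : Fin r) : AH k r :=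
  RingQuot.mkAlgHom k (HeckeRel k r) (FreeAlgebra.ι k (.x i))

theorem xgen_comm {r : ℕ} (i j : Fin r) : xgen k i * xgen k j = xgen k j * xgen k i := by
  simpa [xgen] using RingQuot.mkAlgHom_rel k (HeckeRel.x_comm (k := k) i j)

/-- The image of the symmetric group in the degenerate affine Hecke algebra. -/
noncomputable def tgen {r : ℕ} : Equiv.Perm (Fin r) →* AH k r where
  toFun w := RingQuot.mkAlgHom k (HeckeRel k r) (FreeAlgebra.ι k (.t w))
  map_one' := by
    simpa using RingQuot.mkAlgHom_rel k (HeckeRel.t_one (k := k) (r := r))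
  map_mul' v w := by
    simpa using RingQuot.mkAlgHom_rel k (HeckeRel.t_mul (k := k) v w)

theorem s_mul_x {r : ℕ} (i j : Fin r) (h : (i : ℕ) + 1 = j) :
    tgen k (Equiv.swap i j) * xgen k i = xgen k j * tgen k (Equiv.swap i j) + 1 := by
  simpa [xgen, tgen] using RingQuot.mkAlgHom_rel k (HeckeRel.s_x (k := k) i j h)

theorem x_mul_s {r : ℕ} (i j : Fin r) (h : (i : ℕ) + 1 = j) :
    xgen k i * tgen k (Equiv.swap i j) = tgen k (Equiv.swap i j) * xgen k j + 1 := by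
  simpa [xgen, tgen] using RingQuot.mkAlgHom_rel k (HeckeRel.x_s (k := k) i j h)

theorem x_mul_s_far {r : ℕ} (l i j : Fin r) (h : (i : ℕ) + 1 = j) (hi : l ≠ i) (hj : l ≠ j) :
    xgen k l * tgen k (Equiv.swap i j) = tgen k (Equiv.swap i j) * xgen k l := by
  simpa [xgen, tgen] using RingQuot.mkAlgHom_rel k (HeckeRel.x_s_far (k := k) l i j h hi hj)

/-- The homomorphism from the polynomial algebra `k[x_1, …, x_r]` to the degenerate affine
Hecke algebra. -/
noncomputable def ofPoly (r : ℕ) : MvPolynomial (Fin r) k →ₐ[k] AH k r :=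
  have hc : IsMulCommutative (Algebra.adjoin k (Set.range (xgen k (r := r)))) :=
    Algebra.isMulCommutative_adjoin k (by
      rintro _ ⟨i, rfl⟩ _ ⟨j, rfl⟩; exact xgen_comm k i j)
  letI : CommRing (Algebra.adjoin k (Set.range (xgen k (r := r)))) :=
    { (inferInstance : Ring (Algebra.adjoin k (Set.range (xgen k (r := r))))) with
      mul_comm := hc.is_comm.comm }
  (Algebra.adjoin k (Set.range (xgen k (r := r)))).val.comp
    (aeval fun i => ⟨xgen k i, Algebra.subset_adjoin ⟨i, rfl⟩⟩)

@[simp] theorem ofPoly_X {r : ℕ} (i : Fin r) : ofPoly k r (X i) = xgen k i := by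
  simp [ofPoly]

/-- Symmetric polynomials commute with the symmetric group inside the degenerate affine
Hecke algebra. -/
theorem tgen_mul_ofPoly {r : ℕ} (f : symmetricSubalgebra (Fin r) k) (w : Equiv.Perm (Fin r)) :
    tgen k w * ofPoly k r f = ofPoly k r f * tgen k w := by
  change Commute (tgen k w) (ofPoly k r f)
  refine perm_induction (fun w => Commute (tgen k w) (ofPoly k r f)) ?_ ?_ ?_ w
  · simp
  · intro v w hv hw; rw [map_mul]; exact hv.mul_left hw
  intro i j h
  have hij : i ≠ j := by rintro rfl; omega
  set s := tgen k (Equiv.swap i j) with hs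
  have hsi : s * xgen k i = xgen k j * s + 1 := s_mul_x k i j h
  have hsj : s * xgen k j = xgen k i * s - 1 := by
    rw [hs, x_mul_s k i j h]; abel
  let F : Polynomial (MvPolynomial (Fin r) k) →+* Polynomial (AH k r) :=
    Polynomial.mapRingHom (ofPoly k r).toRingHom
  let q : Fin r → Polynomial (MvPolynomial (Fin r) k) := fun l =>
    Polynomial.X + Polynomial.C (X l)
  have hF : ∀ l, F (q l) = Polynomial.X + Polynomial.C (xgen k l) := by
    intro l; simp [F, q]
  have hfar : ∀ l, l ≠ i → l ≠ j → Commute (Polynomial.C s) (F (q l)) := by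
    intro l hi hj
    rw [hF]
    refine (Polynomial.commute_X _).symm.add_right ?_
    change _ * _ = _ * _
    rw [← Polynomial.C_mul, ← Polynomial.C_mul, x_mul_s_far k l i j h hi hj]
  have hnear : Commute (Polynomial.C s) (F (q i * q j)) := by
    have e : F (q i * q j) = Polynomial.X * Polynomial.X
        + Polynomial.X * Polynomial.C (xgen k i + xgen k j)
        + Polynomial.C (xgen k i * xgen k j) := by
      rw [map_mul, hF, hF, mul_add, add_mul, add_mul, Polynomial.C_mul, Polynomial.C_add,
        mul_add, ← Polynomial.X_mul_C (xgen k i)]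
      abel
    rw [e]
    have hX := (Polynomial.commute_X (Polynomial.C s)).symm
    refine ((hX.mul_right hX).add_right (hX.mul_right ?_)).add_right ?_
    · change _ * _ = _ * _
      rw [← Polynomial.C_mul, ← Polynomial.C_mul, mul_add, add_mul, hsi, hsj]
      congr 1; abel
    · change _ * _ = _ * _
      rw [← Polynomial.C_mul, ← Polynomial.C_mul, ← mul_assoc, hsi, add_mul, mul_assoc, hsj,
        mul_sub, ← mul_assoc, xgen_comm k j i]
      congr 1; simp
  have hall : Commute (Polynomial.C s) (F (∏ l, q l)) := by
    rw [← Finset.mul_prod_erase _ _ (Finset.mem_univ i),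
      ← Finset.mul_prod_erase _ _ (Finset.mem_erase.2 ⟨hij.symm, Finset.mem_univ j⟩),
      ← mul_assoc, map_mul]
    refine hnear.mul_right ?_
    refine Finset.prod_induction _ (fun p => Commute (Polynomial.C s) (F p)) ?_ ?_ ?_
    · intro a b ha hb; rw [map_mul]; exact ha.mul_right hb
    · simp
    · intro l hl
      simp only [Finset.mem_erase] at hl
      exact hfar l hl.2.1 hl.1
  have hesymm : ∀ n, Commute s (ofPoly k r (esymm (Fin r) k n)) := by
    intro n
    by_cases hn : n ≤ r
    · have hc := congrArg (fun p => Polynomial.coeff p (r - n)) hall.eq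
      have hq : (∏ l, q l).coeff (r - n) = esymm (Fin r) k n := by
        have := Finset.prod_X_add_C_coeff (Finset.univ : Finset (Fin r))
          (fun l => (X l : MvPolynomial (Fin r) k)) (k := r - n) (by simp)
        rw [show (∏ l, q l) = ∏ l, (Polynomial.X + Polynomial.C (X l)) from rfl, this]
        simp only [Finset.card_univ, Fintype.card_fin, Nat.sub_sub_self hn]
        rfl
      simp only [Polynomial.coeff_C_mul, Polynomial.coeff_mul_C, F,
        Polynomial.coe_mapRingHom, Polynomial.coeff_map, hq] at hc
      exact hc
    · have : esymm (Fin r) k n = 0 := by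
        rw [esymm, Finset.powersetCard_eq_empty.2 (by simp; omega), Finset.sum_empty]
      simp [this]
  obtain ⟨p, rfl⟩ := esymmAlgHom_fin_surjective (R := k) (n := r) (m := r) le_rfl f
  rw [esymmAlgHom_apply]
  induction p using MvPolynomial.induction_on with
  | C a =>
    rw [algHom_C, AlgHom.commutes]
    exact (Algebra.commutes a s).symm
  | add p q hp hq => rw [map_add, map_add]; exact hp.add_right hq
  | mul_X p n hp =>
    rw [map_mul, map_mul, aeval_X]
    exact hp.mul_right (hesymm _)

/-- The embedding of `Fin a` into `Fin r` with image `{c, …, c + a - 1}`. -/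
def shiftEmb (c a r : ℕ) (h : c + a ≤ r) : Fin a ↪ Fin r where
  toFun i := ⟨c + i, by omega⟩
  inj' i j hij := by
    have := congrArg Fin.val hij
    exact Fin.ext (by simpa using this)

@[simp] theorem shiftEmb_val (c a r : ℕ) (h : c + a ≤ r) (i : Fin a) :
    (shiftEmb c a r h i : ℕ) = c + i := rfl

/-- The symmetric group on `a` letters acting on the letters `{c, …, c + a - 1}` among `r`. -/
noncomputable abbrev shiftPerm (c a r : ℕ) (h : c + a ≤ r) :
    Equiv.Perm (Fin a) →* Equiv.Perm (Fin r) :=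
  Equiv.Perm.viaEmbeddingHom (shiftEmb c a r h)

theorem shiftPerm_apply (c a r : ℕ) (h : c + a ≤ r) (w : Equiv.Perm (Fin a)) (i : Fin a) :
    shiftPerm c a r h w (shiftEmb c a r h i) = shiftEmb c a r h (w i) :=
  Equiv.Perm.viaEmbedding_apply _ _ _

theorem shiftPerm_apply_of_notMem (c a r : ℕ) (h : c + a ≤ r) (w : Equiv.Perm (Fin a))
    (l : Fin r) (hl : l ∉ Set.range (shiftEmb c a r h)) : shiftPerm c a r h w l = l :=
  Equiv.Perm.viaEmbedding_apply_of_notMem _ _ _ hl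

theorem shiftPerm_swap (c a r : ℕ) (h : c + a ≤ r) (i j : Fin a) :
    shiftPerm c a r h (Equiv.swap i j) =
      Equiv.swap (shiftEmb c a r h i) (shiftEmb c a r h j) := by
  ext1 l
  by_cases hl : l ∈ Set.range (shiftEmb c a r h)
  · obtain ⟨l, rfl⟩ := hl
    rw [shiftPerm_apply, (shiftEmb c a r h).injective.swap_apply]
  · rw [shiftPerm_apply_of_notMem _ _ _ _ _ _ hl, Equiv.swap_apply_of_ne_of_ne] <;>
    · rintro rfl; exact hl ⟨_, rfl⟩

/-- The homomorphism from the degenerate affine Hecke algebra of rank `a` to the one of rank `r`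
which sends `x_i` to `x_{c+i}` and `s_i` to `s_{c+i}`. For `a + b = r` the two maps with
`c = 0` (from rank `a`) and `c = a` (from rank `b`) give the usual embedding of the tensor product
of the algebras of ranks `a` and `b`. -/
noncomputable def shiftAH (c a r : ℕ) (h : c + a ≤ r) : AH k a →ₐ[k] AH k r :=
  RingQuot.liftAlgHom k
    ⟨FreeAlgebra.lift k fun g => match g with
        | .x i => xgen k (shiftEmb c a r h i)
        | .t w => tgen k (shiftPerm c a r h w), by
      intro p q hpq
      cases hpq with
      | t_one => simp
      | t_mul v w => simp
      | x_comm i j => simpa using xgen_comm k _ _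
      | s_x i j hij =>
        simp only [map_mul, map_add, map_one, FreeAlgebra.lift_ι_apply, shiftPerm_swap]
        exact s_mul_x k _ _ (by simp only [shiftEmb_val]; omega)
      | x_s i j hij =>
        simp only [map_mul, map_add, map_one, FreeAlgebra.lift_ι_apply, shiftPerm_swap]
        exact x_mul_s k _ _ (by simp only [shiftEmb_val]; omega)
      | x_s_far l i j hij hi hj =>
        simp only [map_mul, FreeAlgebra.lift_ι_apply, shiftPerm_swap]
        exact x_mul_s_far k _ _ _ (by simp only [shiftEmb_val]; omega)
          (fun e => hi ((shiftEmb c a r h).injective e))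
          (fun e => hj ((shiftEmb c a r h).injective e))⟩

@[simp] theorem shiftAH_xgen (c a r : ℕ) (h : c + a ≤ r) (i : Fin a) :
    shiftAH k c a r h (xgen k i) = xgen k (shiftEmb c a r h i) := by
  simp [shiftAH, xgen]

@[simp] theorem shiftAH_tgen (c a r : ℕ) (h : c + a ≤ r) (w : Equiv.Perm (Fin a)) :
    shiftAH k c a r h (tgen k w) = tgen k (shiftPerm c a r h w) := by
  simp [shiftAH, tgen]

/-- An induction principle for the degenerate affine Hecke algebra. -/
theorem AH_induction {r : ℕ} (P : AH k r → Prop) (hk : ∀ z : k, P (algebraMap k _ z))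
    (hx : ∀ i, P (xgen k i)) (ht : ∀ w, P (tgen k w))
    (hadd : ∀ p q, P p → P q → P (p + q)) (hmul : ∀ p q, P p → P q → P (p * q))
    (p : AH k r) : P p := by
  obtain ⟨p, rfl⟩ := RingQuot.mkAlgHom_surjective k (HeckeRel k r) p
  induction p using FreeAlgebra.induction with
  | grade0 z => simpa using hk z
  | grade1 g =>
    cases g with
    | x i => exact hx i
    | t w => exact ht w
  | mul p q hp hq => rw [map_mul]; exact hmul _ _ hp hq
  | add p q hp hq => rw [map_add]; exact hadd _ _ hp hq

theorem xgen_commute_shiftPerm {r : ℕ} (c a : ℕ) (h : c + a ≤ r) (l : Fin r)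
    (hl : ∀ i, l ≠ shiftEmb c a r h i) (w : Equiv.Perm (Fin a)) :
    Commute (xgen k l) (tgen k (shiftPerm c a r h w)) := by
  refine perm_induction
    (fun w => Commute (xgen k l) (tgen k (shiftPerm c a r h w))) ?_ ?_ ?_ w
  · simp
  · intro v w hv hw; rw [map_mul, map_mul]; exact hv.mul_right hw
  · intro i j hij
    rw [shiftPerm_swap]
    exact x_mul_s_far k _ _ _ (by simp only [shiftEmb_val]; omega) (hl i) (hl j)

/-- The two tensor factors commute. -/
theorem shiftAH_commute (a b r : ℕ) (h : a + b = r) (p : AH k a) (q : AH k b) :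
    Commute (shiftAH k 0 a r (by omega) p) (shiftAH k a b r h.le q) := by
  have hne : ∀ (i : Fin a) (j : Fin b),
      shiftEmb 0 a r (by omega) i ≠ shiftEmb a b r h.le j := by
    intro i j e
    have := congrArg Fin.val e
    simp only [shiftEmb_val] at this
    omega
  refine AH_induction k
    (fun p => Commute (shiftAH k 0 a r (by omega) p) (shiftAH k a b r h.le q)) ?_ ?_ ?_ ?_ ?_ p
  · intro z; simpa using Algebra.commute_algebraMap_left z _
  · intro i
    refine AH_induction k
      (fun q => Commute (shiftAH k 0 a r (by omega) (xgen k i)) (shiftAH k a b r h.le q))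
      ?_ ?_ ?_ ?_ ?_ q
    · intro z; simpa using Algebra.commute_algebraMap_right z _
    · intro j; rw [shiftAH_xgen, shiftAH_xgen]; exact xgen_comm k _ _
    · intro w
      rw [shiftAH_xgen, shiftAH_tgen]
      exact xgen_commute_shiftPerm k _ _ _ _ (hne i) w
    · intro p q hp hq; rw [map_add]; exact hp.add_right hq
    · intro p q hp hq; rw [map_mul]; exact hp.mul_right hq
  · intro v
    refine AH_induction k
      (fun q => Commute (shiftAH k 0 a r (by omega) (tgen k v)) (shiftAH k a b r h.le q))
      ?_ ?_ ?_ ?_ ?_ q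
    · intro z; simpa using Algebra.commute_algebraMap_right z _
    · intro j
      rw [shiftAH_xgen, shiftAH_tgen]
      exact (xgen_commute_shiftPerm k _ _ _ _ (fun i => (hne i j).symm) v).symm
    · intro w
      rw [shiftAH_tgen, shiftAH_tgen]
      change _ * _ = _ * _
      rw [← map_mul, ← map_mul]
      congr 1
      ext1 l
      simp only [Equiv.Perm.mul_apply]
      by_cases hl : l ∈ Set.range (shiftEmb 0 a r (by omega))
      · obtain ⟨l, rfl⟩ := hl
        have h1 : ∀ l, shiftEmb 0 a r (by omega) l ∉ Set.range (shiftEmb a b r h.le) := by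
          rintro l ⟨m, hm⟩; exact hne l m hm.symm
        rw [shiftPerm_apply_of_notMem _ _ _ _ _ _ (h1 l), shiftPerm_apply,
          shiftPerm_apply_of_notMem _ _ _ _ _ _ (h1 _)]
      · rw [shiftPerm_apply_of_notMem _ _ _ _ _ l hl, shiftPerm_apply_of_notMem]
        by_cases hl2 : l ∈ Set.range (shiftEmb a b r h.le)
        · obtain ⟨m, rfl⟩ := hl2
          rw [shiftPerm_apply]
          rintro ⟨i, hi⟩
          exact hne _ _ hi
        · rwa [shiftPerm_apply_of_notMem _ _ _ _ _ _ hl2]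
    · intro p q hp hq; rw [map_add]; exact hp.add_right hq
    · intro p q hp hq; rw [map_mul]; exact hp.mul_right hq
  · intro p q hp hq; rw [map_add]; exact hp.add_left hq
  · intro p q hp hq; rw [map_mul]; exact hp.mul_left hq

end Hecke

/-! ### Compositions, parabolic subgroups and permutation modules -/

/-- The index of the part of the composition `lam` which contains position `i`, when positions
`0, 1, 2, …` are distributed from left to right over the parts of `lam`. -/
def blockOf : List ℕ → ℕ → ℕ
  | [], _ => 0
  | p :: ps, i => if i < p then 0 else blockOf ps (i - p) + 1

theorem blockOf_lt_length (l : List ℕ) (i : ℕ) (hi : i < l.sum) : blockOf l i < l.length := by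
  induction l generalizing i with
  | nil => simp at hi
  | cons p ps ih =>
    simp only [List.sum_cons] at hi
    unfold blockOf
    split_ifs with h
    · simp
    · have := ih (i - p) (by omega)
      simp only [List.length_cons]; omega

theorem blockOf_append_left (l m : List ℕ) (i : ℕ) (hi : i < l.sum) :
    blockOf (l ++ m) i = blockOf l i := by
  induction l generalizing i with
  | nil => simp at hi
  | cons p ps ih =>
    simp only [List.sum_cons] at hi
    simp only [List.cons_append, blockOf]
    split_ifs with h
    · rfl
    · rw [ih (i - p) (by omega)]

theorem blockOf_append_right (l m : List ℕ) (i : ℕ) :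
    blockOf (l ++ m) (l.sum + i) = l.length + blockOf m i := by
  induction l with
  | nil => simp
  | cons p ps ih =>
    simp only [List.cons_append, blockOf, List.sum_cons, List.length_cons]
    rw [if_neg (by omega), show p + ps.sum + i - p = ps.sum + i by omega, ih]
    omega

/-- The parabolic subgroup of the symmetric group attached to a composition `lam` of `r`: the
permutations which preserve each of the consecutive blocks of sizes the parts of `lam`. -/
def young (r : ℕ) (lam : List ℕ) : Subgroup (Equiv.Perm (Fin r)) where
  carrier := {w | ∀ i, blockOf lam (w i) = blockOf lam i}
  mul_mem' {v w} hv hw i := by rw [Equiv.Perm.mul_apply, hv, hw]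
  one_mem' i := rfl
  inv_mem' {w} hw i := by rw [← hw (w⁻¹ i)]; simp

section Modules

variable (k : Type u) [CommRing k]

open MulOpposite

/-- The right ideal generated by all `w - 1` with `w` in the parabolic subgroup of `lam`. -/
noncomputable def trivIdeal (r : ℕ) (lam : List ℕ) : Submodule (AH k r)ᵐᵒᵖ (AH k r) :=
  Submodule.span _ {z | ∃ w ∈ young r lam, z = tgen k w - 1}

/-- The right module `M(lam) ⊗_{k S_r} AH_r` over the degenerate affine Hecke algebra, for a
composition `lam` of `r`. By transitivity of induction it is the module
`k ⊗_{k S_lam} AH_r` induced from the trivial right module of the parabolic subgroup, that is, the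
quotient of `AH_r` by the right ideal generated by all `w - 1` with `w` in `S_lam`. Right modules
are modules over the opposite algebra. -/
abbrev AffM (r : ℕ) (lam : List ℕ) : Type u := AH k r ⧸ trivIdeal k r lam

variable {k}

/-- The element `m_lam ⊗ h` of the module. -/
noncomputable def mvec {r : ℕ} (lam : List ℕ) (h : AH k r) : AffM k r lam :=
  Submodule.Quotient.mk h

theorem op_smul_mvec {r : ℕ} (lam : List ℕ) (h g : AH k r) :
    op g • mvec lam h = mvec lam (h * g) := rfl

theorem mvec_tgen {r : ℕ} (lam : List ℕ) (w : Equiv.Perm (Fin r)) (hw : w ∈ young r lam)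
    (h : AH k r) : mvec lam (tgen k w * h) = mvec lam h := by
  refine (Submodule.Quotient.eq _).2 ?_
  have := (trivIdeal k r lam).smul_mem (op h) (Submodule.subset_span ⟨w, hw, rfl⟩)
  simpa [sub_mul] using this

/-- The homomorphism out of `M(lam) ⊗_{k S_r} AH_r` determined by the image `v` of the generator
`m_lam ⊗ 1`, a vector which has to be invariant under the parabolic subgroup. -/
noncomputable def homOfVec {r : ℕ} {lam nu : List ℕ} (v : AffM k r nu)
    (hv : ∀ w ∈ young r lam, op (tgen k w) • v = v) :
    AffM k r lam →ₗ[(AH k r)ᵐᵒᵖ] AffM k r nu :=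
  (trivIdeal k r lam).liftQ
    { toFun := fun h => op h • v
      map_add' := fun g h => by rw [op_add, add_smul]
      map_smul' := fun g h => by
        rw [RingHom.id_apply, ← mul_smul, ← op_unop g, ← op_mul]; rfl }
    (by
      rw [trivIdeal, Submodule.span_le]
      rintro _ ⟨w, hw, rfl⟩
      simp [sub_smul, hv w hw])

@[simp] theorem homOfVec_mvec {r : ℕ} {lam nu : List ℕ} (v : AffM k r nu)
    (hv : ∀ w ∈ young r lam, op (tgen k w) • v = v) (h : AH k r) :
    homOfVec v hv (mvec lam h) = op h • v := rfl

/-- Permutations in the parabolic subgroup of a concatenation are products of permutations in the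
two parabolic subgroups. -/
theorem young_append {a b r : ℕ} (h : a + b = r) (lam nu : List ℕ) (hlam : lam.sum = a)
    (w : Equiv.Perm (Fin r)) (hw : w ∈ young r (lam ++ nu)) :
    ∃ v ∈ young a lam, ∃ v' ∈ young b nu,
      w = shiftPerm 0 a r (by omega) v * shiftPerm a b r h.le v' := by
  have key : ∀ w ∈ young r (lam ++ nu), ∀ i : Fin r, (i : ℕ) < a → (w i : ℕ) < a := by
    intro w hw i hi
    by_contra hcon
    have h1 := hw i
    rw [blockOf_append_left lam nu i (by omega)] at h1
    have h2 := blockOf_append_right lam nu ((w i : ℕ) - a)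
    rw [show lam.sum + ((w i : ℕ) - a) = w i by omega, h1] at h2
    have h3 := blockOf_lt_length lam i (by omega)
    omega
  have key' : ∀ w ∈ young r (lam ++ nu), ∀ i : Fin r, a ≤ (i : ℕ) → a ≤ (w i : ℕ) := by
    intro w hw i hi
    by_contra hcon
    have := key w⁻¹ (inv_mem hw) (w i) (by omega)
    simp at this
    omega
  have hw' := inv_mem hw
  let e0 : Fin a → Fin r := shiftEmb 0 a r (by omega)
  let e1 : Fin b → Fin r := shiftEmb a b r h.le
  have l0 : ∀ w ∈ young r (lam ++ nu), ∀ i : Fin a, (w (e0 i) : ℕ) < a := fun w hw i =>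
    key w hw _ (by simp [e0])
  have l1 : ∀ w ∈ young r (lam ++ nu), ∀ i : Fin b, a ≤ (w (e1 i) : ℕ) := fun w hw i =>
    key' w hw _ (by simp [e1])
  let g0 (w) (hw : w ∈ young r (lam ++ nu)) : Fin a → Fin a := fun i => ⟨w (e0 i), l0 w hw i⟩
  let g1 (w) (hw : w ∈ young r (lam ++ nu)) : Fin b → Fin b := fun i =>
    ⟨w (e1 i) - a, by have := l1 w hw i; omega⟩
  have he0 : ∀ w hw i, e0 (g0 w hw i) = w (e0 i) := fun w hw i => Fin.ext (by simp [e0, g0])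
  have he1 : ∀ w hw i, e1 (g1 w hw i) = w (e1 i) := fun w hw i =>
    Fin.ext (by have := l1 w hw i; simp [e1, g1] at this ⊢; omega)
  have i0 : Function.Injective e0 := (shiftEmb 0 a r (by omega)).injective
  have i1 : Function.Injective e1 := (shiftEmb a b r h.le).injective
  let v : Equiv.Perm (Fin a) := ⟨g0 w hw, g0 w⁻¹ hw',
    fun i => i0 (by rw [he0 _ hw', he0 _ hw]; simp),
    fun i => i0 (by rw [he0 _ hw, he0 _ hw']; simp)⟩
  let v' : Equiv.Perm (Fin b) := ⟨g1 w hw, g1 w⁻¹ hw',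
    fun i => i1 (by rw [he1 _ hw', he1 _ hw]; simp),
    fun i => i1 (by rw [he1 _ hw, he1 _ hw']; simp)⟩
  refine ⟨v, ?_, v', ?_, ?_⟩
  · intro i
    have := hw (e0 i)
    rw [blockOf_append_left _ _ _ (by have := l0 w hw i; omega),
      blockOf_append_left _ _ _ (by simp [e0]; omega)] at this
    simpa [v, g0, e0] using this
  · intro i
    have h1 := hw (e1 i)
    have h2 := blockOf_append_right lam nu ((w (e1 i) : ℕ) - a)
    have h3 := blockOf_append_right lam nu i
    rw [show lam.sum + ((w (e1 i) : ℕ) - a) = w (e1 i) by have := l1 w hw i; omega] at h2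
    rw [show lam.sum + (i : ℕ) = e1 i by simp [e1]; omega] at h3
    have : blockOf nu ((w (e1 i) : ℕ) - a) = blockOf nu i := by omega
    simpa [v', g1] using this
  · ext1 l
    rw [Equiv.Perm.mul_apply]
    by_cases hl : (l : ℕ) < a
    · have hl0 : l = e0 ⟨l, hl⟩ := Fin.ext (by simp [e0])
      rw [shiftPerm_apply_of_notMem a b r h.le v' l, hl0]
      · exact (he0 w hw _).symm.trans (shiftPerm_apply 0 a r (by omega) v ⟨l, hl⟩).symm
      · rintro ⟨m, rfl⟩; simp at hl
    · have hl1 : l = e1 ⟨l - a, by omega⟩ := Fin.ext (by simp [e1]; omega)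
      have e2 : shiftPerm a b r h.le v' l = w l := by
        rw [hl1]
        exact (shiftPerm_apply a b r h.le v' _).trans (he1 w hw _)
      rw [e2, shiftPerm_apply_of_notMem]
      rintro ⟨m, hm⟩
      have := key' w hw l (by omega)
      rw [← hm] at this
      simp at this
      omega

theorem young_append_left {a b r : ℕ} (h : a + b = r) (lam nu : List ℕ) (hlam : lam.sum = a)
    (v : Equiv.Perm (Fin a)) (hv : v ∈ young a lam) :
    shiftPerm 0 a r (by omega) v ∈ young r (lam ++ nu) := by
  intro l
  by_cases hl : (l : ℕ) < a
  · have hl0 : l = shiftEmb 0 a r (by omega) ⟨l, hl⟩ := Fin.ext (by simp)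
    rw [hl0, shiftPerm_apply, shiftEmb_val, shiftEmb_val, zero_add, zero_add,
      blockOf_append_left _ _ _ (by omega), blockOf_append_left _ _ _ (by simp; omega)]
    exact hv _
  · rw [shiftPerm_apply_of_notMem]
    rintro ⟨m, rfl⟩; simp at hl

theorem young_append_right {a b r : ℕ} (h : a + b = r) (lam nu : List ℕ) (hlam : lam.sum = a)
    (v : Equiv.Perm (Fin b)) (hv : v ∈ young b nu) :
    shiftPerm a b r h.le v ∈ young r (lam ++ nu) := by
  subst hlam
  intro l
  by_cases hl : (l : ℕ) < lam.sum
  · rw [shiftPerm_apply_of_notMem]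
    rintro ⟨m, rfl⟩; simp at hl
  · have hl0 : l = shiftEmb lam.sum b r h.le ⟨l - lam.sum, by omega⟩ :=
      Fin.ext (by simp; omega)
    rw [hl0, shiftPerm_apply, shiftEmb_val, shiftEmb_val,
      blockOf_append_right, blockOf_append_right]
    exact congrArg _ (hv _)

theorem juxt_aux_left {a b r : ℕ} (h : a + b = r) (lam nu : List ℕ) (hlam : lam.sum = a)
    (g : AH k a) (hg : g ∈ trivIdeal k a lam) (g' : AH k b) :
    shiftAH k 0 a r (by omega) g * shiftAH k a b r h.le g' ∈ trivIdeal k r (lam ++ nu) := by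
  induction hg using Submodule.span_induction with
  | mem x hx =>
    obtain ⟨w, hw, rfl⟩ := hx
    refine (trivIdeal k r (lam ++ nu)).smul_mem (op _) (Submodule.subset_span
      ⟨_, young_append_left h lam nu hlam w hw, ?_⟩)
    simp
  | zero => simp
  | add x y _ _ hx hy => rw [map_add, add_mul]; exact add_mem hx hy
  | smul c x _ hx =>
    have e : c • x = x * unop c := rfl
    have hc := (shiftAH_commute k a b r h (unop c) g').eq
    rw [e, map_mul, mul_assoc, hc, ← mul_assoc]
    exact (trivIdeal k r (lam ++ nu)).smul_mem (op _) hx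

theorem juxt_aux_right {a b r : ℕ} (h : a + b = r) (lam nu : List ℕ) (hlam : lam.sum = a)
    (g : AH k a) (g' : AH k b) (hg : g' ∈ trivIdeal k b nu) :
    shiftAH k 0 a r (by omega) g * shiftAH k a b r h.le g' ∈ trivIdeal k r (lam ++ nu) := by
  rw [(shiftAH_commute k a b r h g g').eq]
  induction hg using Submodule.span_induction with
  | mem x hx =>
    obtain ⟨w, hw, rfl⟩ := hx
    refine (trivIdeal k r (lam ++ nu)).smul_mem (op _) (Submodule.subset_span
      ⟨_, young_append_right h lam nu hlam w hw, ?_⟩)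
    simp
  | zero => simp
  | add x y _ _ hx hy => rw [map_add, add_mul]; exact add_mem hx hy
  | smul c x _ hx =>
    have e : c • x = x * unop c := rfl
    have hc := (shiftAH_commute k a b r h g (unop c)).eq
    rw [e, map_mul, mul_assoc, ← hc, ← mul_assoc]
    exact (trivIdeal k r (lam ++ nu)).smul_mem (op _) hx

/-- The canonical balanced map
`(M(lam) ⊗ AH_a) × (M(nu) ⊗ AH_b) → M(lam * nu) ⊗ AH_{a+b}`, where `lam` is a composition of `a`
and `nu` is a composition of `b`, which sends `(m_lam ⊗ g, m_nu ⊗ g')` to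
`m_{lam * nu} ⊗ (g ⊗ g')`. It identifies the target with the induction product of the two
modules. -/
noncomputable def juxt {a b r : ℕ} (h : a + b = r) (lam nu : List ℕ) (hlam : lam.sum = a) :
    AffM k a lam → AffM k b nu → AffM k r (lam ++ nu) :=
  Quotient.map₂
    (fun g g' => shiftAH k 0 a r (by omega) g * shiftAH k a b r h.le g') (by
      intro g₁ g₂ hg g₁' g₂' hg'
      have e := (Submodule.quotientRel_def _).1 hg
      have e' := (Submodule.quotientRel_def _).1 hg'
      refine (Submodule.quotientRel_def _).2 ?_
      have := add_mem (juxt_aux_left h lam nu hlam _ e g₁')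
        (juxt_aux_right h lam nu hlam g₂ _ e')
      simpa only [map_sub, sub_mul, mul_sub, sub_add_sub_cancel] using this)

theorem juxt_mvec {a b r : ℕ} (h : a + b = r) (lam nu : List ℕ) (hlam : lam.sum = a)
    (g : AH k a) (g' : AH k b) :
    juxt h lam nu hlam (mvec lam g) (mvec nu g') =
      mvec (lam ++ nu) (shiftAH k 0 a r (by omega) g * shiftAH k a b r h.le g') := rfl

/-- The tensor product (horizontal composition) of two homomorphisms: the homomorphism which
the induction product of `f` and `g` induces under the canonical isomorphisms. It sends
`m ⊗ 1 = (m_lam ⊗ m_nu) ⊗ 1` to `f m_lam ⊗ g m_nu`. -/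
noncomputable def juxtHom {a b r : ℕ} (h : a + b = r) {lam lam' nu nu' : List ℕ}
    (hlam : lam.sum = a) (hlam' : lam'.sum = a)
    (f : AffM k a lam →ₗ[(AH k a)ᵐᵒᵖ] AffM k a lam')
    (g : AffM k b nu →ₗ[(AH k b)ᵐᵒᵖ] AffM k b nu') :
    AffM k r (lam ++ nu) →ₗ[(AH k r)ᵐᵒᵖ] AffM k r (lam' ++ nu') :=
  homOfVec (juxt h lam' nu' hlam' (f (mvec lam 1)) (g (mvec nu 1))) (by
    intro w hw
    obtain ⟨v, hv, v', hv', rfl⟩ := young_append h lam nu hlam w hw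
    obtain ⟨p, hp⟩ := Submodule.Quotient.mk_surjective _ (f (mvec lam 1))
    obtain ⟨q, hq⟩ := Submodule.Quotient.mk_surjective _ (g (mvec nu 1))
    have hp' : mvec lam' (p * tgen k v) = mvec lam' p := by
      change op (tgen k v) • (Submodule.Quotient.mk p : AffM k a lam') = Submodule.Quotient.mk p
      rw [hp, ← map_smul, op_smul_mvec, one_mul]
      congr 1
      simpa using mvec_tgen lam v hv 1
    have hq' : mvec nu' (q * tgen k v') = mvec nu' q := by
      change op (tgen k v') • (Submodule.Quotient.mk q : AffM k b nu') = Submodule.Quotient.mk q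
      rw [hq, ← map_smul, op_smul_mvec, one_mul]
      congr 1
      simpa using mvec_tgen nu v' hv' 1
    rw [← hp, ← hq]
    change op _ • juxt h lam' nu' hlam' (mvec lam' p) (mvec nu' q) =
      juxt h lam' nu' hlam' (mvec lam' p) (mvec nu' q)
    conv_rhs => rw [← hp', ← hq']
    rw [juxt_mvec, juxt_mvec, op_smul_mvec]
    congr 1
    rw [map_mul, map_mul, map_mul, shiftAH_tgen, shiftAH_tgen]
    have hc := (shiftAH_commute k a b r h (tgen k v) q).eq
    rw [shiftAH_tgen] at hc
    rw [mul_assoc, ← mul_assoc (shiftAH k a b r h.le q), ← hc, mul_assoc, mul_assoc])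

theorem juxt_zero_left {a b r : ℕ} (h : a + b = r) (lam nu : List ℕ) (hlam : lam.sum = a)
    (y : AffM k b nu) : juxt h lam nu hlam 0 y = 0 := by
  obtain ⟨q, rfl⟩ := Submodule.Quotient.mk_surjective _ y
  have e := juxt_mvec h lam nu hlam 0 q
  rw [map_zero, zero_mul] at e
  exact e

theorem juxt_zero_right {a b r : ℕ} (h : a + b = r) (lam nu : List ℕ) (hlam : lam.sum = a)
    (x : AffM k a lam) : juxt h lam nu hlam x 0 = 0 := by
  obtain ⟨p, rfl⟩ := Submodule.Quotient.mk_surjective _ x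
  have e := juxt_mvec h lam nu hlam p 0
  rw [map_zero, mul_zero] at e
  exact e

/-- For a composition `(c)` with one part the parabolic subgroup is the full symmetric group. -/
theorem mem_young_single {r c : ℕ} (h : r ≤ c) (w : Equiv.Perm (Fin r)) : w ∈ young r [c] := by
  intro i
  simp only [blockOf]
  rw [if_pos (by omega), if_pos (by omega)]

/-- The element `m_lam w` for a right coset `S_lam w`. -/
noncomputable def cosetVec (k : Type u) [CommRing k] {r : ℕ} (lam : List ℕ) :
    Quotient (QuotientGroup.rightRel (young r lam)) → AffM k r lam :=
  Quotient.lift (fun w => mvec lam (tgen k w)) (by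
    intro v w hvw
    have h : w * v⁻¹ ∈ young r lam := QuotientGroup.rightRel_apply.1 hvw
    rw [← mvec_tgen lam _ h, ← map_mul]
    simp)

open scoped Classical in
/-- The sum of the elements `m_lam w` over all right cosets `S_lam w` in the symmetric group, for
example over the minimal length coset representatives. -/
noncomputable def cosetSum (k : Type u) [CommRing k] (r : ℕ) (lam : List ℕ) : AffM k r lam :=
  ∑ q : Quotient (QuotientGroup.rightRel (young r lam)), cosetVec k lam q

theorem cosetSum_invariant (r : ℕ) (lam : List ℕ) (w : Equiv.Perm (Fin r)) :
    op (tgen k w) • cosetSum k r lam = cosetSum k r lam := by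
  classical
  rw [cosetSum, Finset.smul_sum]
  let e : Quotient (QuotientGroup.rightRel (young r lam)) ≃
      Quotient (QuotientGroup.rightRel (young r lam)) :=
    Quotient.congr (Equiv.mulRight w) (by
      intro x y
      simp [QuotientGroup.rightRel_apply, mul_assoc])
  refine Fintype.sum_equiv e _ _ ?_
  intro q
  induction q using Quotient.inductionOn with
  | _ x =>
    change op (tgen k w) • mvec lam (tgen k x) = mvec lam (tgen k (x * w))
    rw [op_smul_mvec, map_mul]

end Modules

/-! ### The degenerate affine Schur category -/

/-- Objects of the degenerate affine Schur category over `k`: all compositions, that is, finite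
sequences of natural numbers, zero parts being allowed. -/
@[ext] structure ASchur (k : Type u) : Type where
  /-- The parts of the composition. -/
  parts : List ℕ

namespace ASchur

open CategoryTheory MulOpposite

theorem str_sum {r s : ℕ} (h : [r].sum = s) : r = s := by simpa using h


variable {k : Type u} [CommRing k]
/-- Morphisms `lam → nu`. If `lam` and `nu` are compositions of the same number `r`, a morphism is a
homomorphism of right `AH_r`-modules `M(lam) ⊗ AH_r → M(nu) ⊗ AH_r`; if they are compositions of
different numbers there is no such `r` and the morphism space is zero. -/
def Hom (X Y : ASchur k) : Type u :=
  ∀ r : {r : ℕ // X.parts.sum = r ∧ Y.parts.sum = r},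
    (AffM k r.1 X.parts →ₗ[(AH k r.1)ᵐᵒᵖ] AffM k r.1 Y.parts)

noncomputable instance (X Y : ASchur k) : AddCommGroup (Hom X Y) :=
  @Pi.addCommGroup _ _ fun _ => LinearMap.addCommGroup

theorem homOfVec_eq_zero {r : ℕ} {lam nu : List ℕ} (v : AffM k r nu)
    (hv : ∀ w ∈ young r lam, op (tgen k w) • v = v) (h : v = 0) :
    homOfVec v hv = 0 := by
  refine Submodule.linearMap_qext _ (LinearMap.ext fun z => ?_)
  change op z • v = 0
  rw [h, smul_zero]

/-- Composition of morphisms, first `f` and then `g`. -/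
noncomputable def Hom.comp {X Y Z : ASchur k} (f : Hom X Y) (g : Hom Y Z) : Hom X Z := fun r =>
  if hY : Y.parts.sum = r.1 then (g ⟨r.1, hY, r.2.2⟩).comp (f ⟨r.1, r.2.1, hY⟩) else 0

theorem Hom.comp_pos {X Y Z : ASchur k} (f : Hom X Y) (g : Hom Y Z) (r)
    (hY : Y.parts.sum = r.1) :
    f.comp g r = (g ⟨r.1, hY, r.2.2⟩).comp (f ⟨r.1, r.2.1, hY⟩) := dif_pos hY

theorem Hom.comp_neg {X Y Z : ASchur k} (f : Hom X Y) (g : Hom Y Z) (r)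
    (hY : ¬ Y.parts.sum = r.1) : f.comp g r = 0 := dif_neg hY

theorem Hom.add_comp {X Y Z : ASchur k} (f f' : Hom X Y) (g : Hom Y Z) :
    (f + f').comp g = f.comp g + f'.comp g := by
  funext r
  by_cases hY : Y.parts.sum = r.1
  · exact (Hom.comp_pos _ _ _ hY).trans ((LinearMap.comp_add _ _ _).trans
      (congrArg₂ (· + ·) (Hom.comp_pos _ _ _ hY) (Hom.comp_pos _ _ _ hY)).symm)
  · exact (Hom.comp_neg _ _ _ hY).trans ((add_zero _).symm.trans
      (congrArg₂ (· + ·) (Hom.comp_neg _ _ _ hY) (Hom.comp_neg _ _ _ hY)).symm)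

theorem Hom.comp_add {X Y Z : ASchur k} (f : Hom X Y) (g g' : Hom Y Z) :
    f.comp (g + g') = f.comp g + f.comp g' := by
  funext r
  by_cases hY : Y.parts.sum = r.1
  · exact (Hom.comp_pos _ _ _ hY).trans ((LinearMap.add_comp _ _ _).trans
      (congrArg₂ (· + ·) (Hom.comp_pos _ _ _ hY) (Hom.comp_pos _ _ _ hY)).symm)
  · exact (Hom.comp_neg _ _ _ hY).trans ((add_zero _).symm.trans
      (congrArg₂ (· + ·) (Hom.comp_neg _ _ _ hY) (Hom.comp_neg _ _ _ hY)).symm)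

theorem Hom.comp_assoc {W X Y Z : ASchur k} (f : Hom W X) (g : Hom X Y) (h : Hom Y Z) :
    (f.comp g).comp h = f.comp (g.comp h) := by
  funext r
  by_cases hX : X.parts.sum = r.1
  · rw [Hom.comp_pos f _ r hX]
    by_cases hY : Y.parts.sum = r.1
    · rw [Hom.comp_pos _ h r hY, Hom.comp_pos f g ⟨r.1, r.2.1, hY⟩ hX,
        Hom.comp_pos g h ⟨r.1, hX, r.2.2⟩ hY, LinearMap.comp_assoc]
    · rw [Hom.comp_neg _ h r hY, Hom.comp_neg g h ⟨r.1, hX, r.2.2⟩ hY, LinearMap.zero_comp]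
  · rw [Hom.comp_neg f _ r hX]
    by_cases hY : Y.parts.sum = r.1
    · rw [Hom.comp_pos _ h r hY, Hom.comp_neg f g ⟨r.1, r.2.1, hY⟩ hX, LinearMap.comp_zero]
    · rw [Hom.comp_neg _ h r hY]

noncomputable instance : Category (ASchur k) where
  Hom X Y := Hom X Y
  id X := fun _ => LinearMap.id
  comp f g := Hom.comp f g
  id_comp f := by
    funext r
    exact (Hom.comp_pos _ _ _ r.2.1).trans (LinearMap.comp_id _)
  comp_id f := by
    funext r
    exact (Hom.comp_pos _ _ _ r.2.2).trans (LinearMap.id_comp _)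
  assoc f g h := Hom.comp_assoc f g h

noncomputable instance : Preadditive (ASchur k) where
  homGroup X Y := inferInstanceAs (AddCommGroup (Hom X Y))
  add_comp _ _ _ f f' g := Hom.add_comp f f' g
  comp_add _ _ _ f g g' := Hom.comp_add f g g'

/-- The tensor product of objects is concatenation of compositions. -/
abbrev tens (X Y : ASchur k) : ASchur k := ⟨X.parts ++ Y.parts⟩

/-- The tensor product of morphisms, drawn as horizontal juxtaposition of string diagrams. -/
noncomputable def tensHom {X Y X' Y' : ASchur k} (f : X ⟶ Y) (g : X' ⟶ Y') :
    tens X X' ⟶ tens Y Y' := fun r =>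
  if e : Y.parts.sum = X.parts.sum then
    juxtHom (a := X.parts.sum) (b := X'.parts.sum)
      (by simpa using r.2.1) rfl e (f ⟨_, rfl, e⟩)
      (g ⟨_, rfl, by have := r.2; simp only [List.sum_append] at this; omega⟩)
  else 0

theorem zero_tensHom {X Y X' Y' : ASchur k} (g : X' ⟶ Y') :
    tensHom (0 : X ⟶ Y) g = 0 := by
  funext r
  unfold tensHom
  split_ifs with e
  · exact homOfVec_eq_zero _ _ (juxt_zero_left _ _ _ _ _)
  · rfl

theorem tensHom_zero {X Y X' Y' : ASchur k} (f : X ⟶ Y) :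
    tensHom f (0 : X' ⟶ Y') = 0 := by
  funext r
  unfold tensHom
  split_ifs with e
  · exact homOfVec_eq_zero _ _ (juxt_zero_right _ _ _ _ _)
  · rfl

variable (k)

/-- The object `(r)`, drawn as a single string of thickness `r`. -/
abbrev str (r : ℕ) : ASchur k := ⟨[r]⟩

theorem single_invariant {r c : ℕ} (h : r ≤ c) (p : AH k r)
    (hp : ∀ w, tgen k w * p = p * tgen k w) (w : Equiv.Perm (Fin r)) :
    op (tgen k w) • mvec [c] p = mvec [c] p := by
  rw [op_smul_mvec, ← hp, mvec_tgen _ _ (mem_young_single h w)]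

/-- The two-fold merge `(a, b) → (a + b)`, which maps `m_{(a,b)} ⊗ 1` to `m_{(a+b)} ⊗ 1`. -/
noncomputable def merge (a b : ℕ) : tens (str k a) (str k b) ⟶ str k (a + b) :=
  fun r => homOfVec (lam := [a] ++ [b]) (nu := [a + b]) (mvec [a + b] 1) fun w _ =>
    single_invariant k (by have := r.2.2; simp at this; omega) 1 (by simp) w

/-- The two-fold split `(a + b) → (a, b)`, which maps `m_{(a+b)} ⊗ 1` to the sum of
`m_{(a,b)} ⊗ w` over representatives `w` of the right cosets of `S_a × S_b` in `S_{a+b}`. -/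
noncomputable def split (a b : ℕ) : str k (a + b) ⟶ tens (str k a) (str k b) :=
  fun r => homOfVec (lam := [a + b]) (nu := [a] ++ [b]) (cosetSum k r ([a] ++ [b]))
    fun w _ => cosetSum_invariant _ _ w

/-- The pin: for a symmetric polynomial `f` in `x_1, …, x_r`, the endomorphism of `(r)` which maps
`m_{(r)} ⊗ 1` to `m_{(r)} ⊗ f`. -/
noncomputable def pin (r : ℕ) : symmetricSubalgebra (Fin r) k →+ End (str k r) where
  toFun f := fun s =>
    homOfVec (lam := [r]) (nu := [r])
      (mvec [r] (ofPoly k s (rename (finCongr (str_sum s.2.1)) (f : MvPolynomial (Fin r) k))))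
      (by
        intro w _
        refine single_invariant k (str_sum s.2.1).ge _ (fun w => ?_) w
        obtain ⟨s, hs, hs'⟩ := s
        obtain rfl := str_sum hs
        simpa using tgen_mul_ofPoly k f w)
  map_zero' := by
    funext s
    refine Submodule.linearMap_qext _ (LinearMap.ext fun z => ?_)
    change op z • mvec [r] (ofPoly k s (rename _ (0 : MvPolynomial (Fin r) k))) = 0
    rw [map_zero, map_zero]
    exact smul_zero _
  map_add' f g := by
    funext s
    refine Submodule.linearMap_qext _ (LinearMap.ext fun z => ?_)
    change op z • mvec [r] (ofPoly k s (rename _ (f + g : MvPolynomial (Fin r) k))) =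
      op z • mvec [r] (ofPoly k s (rename _ (f : MvPolynomial (Fin r) k))) +
      op z • mvec [r] (ofPoly k s (rename _ (g : MvPolynomial (Fin r) k)))
    rw [map_add, map_add, ← smul_add]
    rfl

end ASchur

/-! ### Generating functions -/

section Generating

/-- Application of a ring homomorphism to the coefficients of Laurent series. -/
noncomputable def mapCoeff {R S : Type*} [CommRing R] [CommRing S] (f : R →+* S) :
    LaurentSeries R →+* LaurentSeries S where
  toFun F := F.map f
  map_one' := HahnSeries.map_one f.toMonoidWithZeroHom
  map_mul' _ _ := HahnSeries.map_mul (f : R →ₙ+* S)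
  map_zero' := HahnSeries.map_zero (f : ZeroHom R S)
  map_add' _ _ := HahnSeries.map_add (f : R →+ S)

theorem mapCoeff_coeff {R S : Type*} [CommRing R] [CommRing S] (f : R →+* S) (F : LaurentSeries R)
    (n : ℤ) : (mapCoeff f F).coeff n = f (F.coeff n) := rfl

theorem mapCoeff_single {R S : Type*} [CommRing R] [CommRing S] (f : R →+* S) (n : ℤ) (x : R) :
    mapCoeff f (HahnSeries.single n x) = HahnSeries.single n (f x) :=
  HahnSeries.map_single (f : ZeroHom R S)

variable (k : Type u) [CommRing k]

/-- The polynomial `∏ (u + c - x_j)`, the product being over `j = 1, …, r`, viewed as a formal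
Laurent series in `u⁻¹` over the polynomial ring. Here and below, the variable of Laurent series is
`u⁻¹`, so that `u` is the monomial with exponent `-1`. -/
noncomputable def elemPoly (r : ℕ) (c : ℤ) : LaurentSeries (MvPolynomial (Fin r) k) :=
  ∏ j : Fin r, (HahnSeries.single (-1 : ℤ) (1 : MvPolynomial (Fin r) k) +
    (c : LaurentSeries (MvPolynomial (Fin r) k)) - HahnSeries.C (X j))

theorem isUnit_linear {R : Type*} [CommRing R] (c : ℤ) (x : R) :
    IsUnit (HahnSeries.single (-1 : ℤ) (1 : R) + (c : LaurentSeries R) - HahnSeries.C x) := by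
  have h1 : IsUnit (HahnSeries.single (-1 : ℤ) (1 : R)) :=
    IsUnit.of_mul_eq_one (HahnSeries.single (1 : ℤ) (1 : R))
      (by rw [HahnSeries.single_mul_single]; simp)
  have h2 : IsUnit (1 + PowerSeries.X * PowerSeries.C ((c : R) - x)) :=
    PowerSeries.isUnit_iff_constantCoeff.2 (by simp)
  have h3 := h1.mul (h2.map (HahnSeries.ofPowerSeries ℤ R))
  have e : HahnSeries.ofPowerSeries ℤ R (1 + PowerSeries.X * PowerSeries.C ((c : R) - x)) =
      1 + HahnSeries.single 1 1 * HahnSeries.C ((c : R) - x) := by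
    rw [RingHom.map_add, RingHom.map_one, RingHom.map_mul, HahnSeries.ofPowerSeries_X,
      HahnSeries.ofPowerSeries_C]
  have e2 : HahnSeries.single (-1 : ℤ) (1 : R) + (c : LaurentSeries R) - HahnSeries.C x =
      HahnSeries.single (-1 : ℤ) (1 : R) *
        (1 + HahnSeries.single 1 1 * HahnSeries.C ((c : R) - x)) := by
    rw [mul_add, mul_one, ← mul_assoc, HahnSeries.single_mul_single, RingHom.map_sub, map_intCast,
      add_sub_assoc]
    congr 1
    have : HahnSeries.single ((-1 : ℤ) + 1) ((1 : R) * 1) = (1 : LaurentSeries R) := by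
      rw [mul_one]; rfl
    rw [this, one_mul]
  rw [e2, ← e]
  exact h3

theorem isUnit_elemPoly (r : ℕ) (c : ℤ) : IsUnit (elemPoly k r c) :=
  IsUnit.prod_univ_iff.2 fun _ => isUnit_linear c _

/-- The generating function of complete symmetric polynomials, `∏ 1 / (u - x_j)`, the product being
over `j = 1, …, r`, viewed as a formal Laurent series in `u⁻¹` over the polynomial ring. -/
noncomputable def compPoly (r : ℕ) : LaurentSeries (MvPolynomial (Fin r) k) :=
  Ring.inverse (elemPoly k r 0)

theorem elemPoly_mul_compPoly (r : ℕ) : elemPoly k r 0 * compPoly k r = 1 :=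
  Ring.mul_inverse_cancel _ (isUnit_elemPoly k r 0)

theorem mapCoeff_rename_elemPoly (r : ℕ) (c : ℤ) (e : Equiv.Perm (Fin r)) :
    mapCoeff (rename e : MvPolynomial (Fin r) k →ₐ[k] MvPolynomial (Fin r) k).toRingHom
      (elemPoly k r c) = elemPoly k r c := by
  rw [elemPoly, map_prod]
  refine Fintype.prod_equiv e _ _ fun j => ?_
  rw [map_sub, map_add, map_intCast, mapCoeff_single, map_one]
  congr 1
  change mapCoeff _ (HahnSeries.single 0 _) = HahnSeries.single 0 _
  rw [mapCoeff_single]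
  simp

theorem mapCoeff_rename_compPoly (r : ℕ) (e : Equiv.Perm (Fin r)) :
    mapCoeff (rename e : MvPolynomial (Fin r) k →ₐ[k] MvPolynomial (Fin r) k).toRingHom
      (compPoly k r) = compPoly k r := by
  refine (isUnit_elemPoly k r 0).mul_left_cancel ?_
  conv_lhs => rw [← mapCoeff_rename_elemPoly k r 0 e]
  rw [← map_mul, elemPoly_mul_compPoly, map_one]

variable {k}

/-- A Laurent series all of whose coefficients are symmetric polynomials, as a Laurent series over
the ring of symmetric polynomials. -/
def symLift {r : ℕ} (F : LaurentSeries (MvPolynomial (Fin r) k))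
    (hF : ∀ e : Equiv.Perm (Fin r),
      mapCoeff (rename e : MvPolynomial (Fin r) k →ₐ[k] MvPolynomial (Fin r) k).toRingHom F = F) :
    LaurentSeries (symmetricSubalgebra (Fin r) k) where
  coeff n := ⟨F.coeff n, fun e => congrArg (fun G => HahnSeries.coeff G n) (hF e)⟩
  isPWO_support' := F.isPWO_support.mono fun _ hn h0 => hn (Subtype.ext h0)

variable (k)

/-- `∏ (u + c - x_j)` over `j = 1, …, r`, as a Laurent series in `u⁻¹` over the ring of symmetric
polynomials. -/
noncomputable def elemGen (r : ℕ) (c : ℤ) : LaurentSeries (symmetricSubalgebra (Fin r) k) :=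
  symLift (elemPoly k r c) (mapCoeff_rename_elemPoly k r c)

/-- `∏ 1 / (u - x_j)` over `j = 1, …, r`, as a Laurent series in `u⁻¹` over the ring of symmetric
polynomials. -/
noncomputable def compGen (r : ℕ) : LaurentSeries (symmetricSubalgebra (Fin r) k) :=
  symLift (compPoly k r) (mapCoeff_rename_compPoly k r)

/-- Base change of symmetric polynomials from the integers to `k`. -/
noncomputable def baseChange (r : ℕ) :
    symmetricSubalgebra (Fin r) ℤ →+* symmetricSubalgebra (Fin r) k where
  toFun f := ⟨map (Int.castRingHom k) f, IsSymmetric.map f.2 _⟩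
  map_one' := Subtype.ext (map_one _)
  map_mul' f g := Subtype.ext (map_mul _ (f : MvPolynomial (Fin r) ℤ) g)
  map_zero' := Subtype.ext (map_zero _)
  map_add' f g := Subtype.ext (map_add _ (f : MvPolynomial (Fin r) ℤ) g)

end Generating

/-! ### Pins carrying generating functions -/

namespace ASchur

open CategoryTheory

variable (k : Type u) [CommRing k]

/-- The pin applied to the coefficients of a Laurent series: a Laurent series in `u⁻¹` with
coefficients in the endomorphism ring of `(r)`. -/
noncomputable def pinSeries (r : ℕ) (F : LaurentSeries (symmetricSubalgebra (Fin r) k)) :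
    LaurentSeries (End (str k r)) :=
  F.map (pin k r)

/-- The map sending an endomorphism `p` of the string `(a)` to the endomorphism of `(a + b)`
obtained by splitting into `(a, b)`, applying `p` to the left string, and merging. -/
noncomputable def bubbleLeft (a b : ℕ) :
    ZeroHom (End (str k a)) (End (str k (a + b))) where
  toFun p := split k a b ≫ tensHom (X := str k a) (Y := str k a) p (𝟙 (str k b)) ≫ merge k a b
  map_zero' := by
    refine (congrArg (fun q => split k a b ≫ q ≫ merge k a b)
      (zero_tensHom (X := str k a) (Y := str k a) (𝟙 (str k b)))).trans ?_
    rw [Limits.zero_comp, Limits.comp_zero]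

/-- The map sending an endomorphism `p` of the string `(b)` to the endomorphism of `(a + b)`
obtained by splitting into `(a, b)`, applying `p` to the right string, and merging. -/
noncomputable def bubbleRight (a b : ℕ) :
    ZeroHom (End (str k b)) (End (str k (a + b))) where
  toFun p := split k a b ≫ tensHom (X' := str k b) (Y' := str k b) (𝟙 (str k a)) p ≫ merge k a b
  map_zero' := by
    refine (congrArg (fun q => split k a b ≫ q ≫ merge k a b)
      (tensHom_zero (X' := str k b) (Y' := str k b) (𝟙 (str k a)))).trans ?_
    rw [Limits.zero_comp, Limits.comp_zero]

/-- Split `(a + b)` into `(a, b)`, put the pin `∏ 1 / (u - x_j)` on the left string, and merge. -/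
noncomputable def leftPinned (a b : ℕ) : LaurentSeries (End (str k (a + b))) :=
  (pinSeries k a (compGen k a)).map (bubbleLeft k a b)

/-- Split `(a + b)` into `(a, b)`, put the pin `∏ 1 / (u - x_j)` on the right string, and merge. -/
noncomputable def rightPinned (a b : ℕ) : LaurentSeries (End (str k (a + b))) :=
  (pinSeries k b (compGen k b)).map (bubbleRight k a b)

/-- The string `(r)` carrying the pin `∏ 1 / (u - x_j)` and, above it, the pin
`∏ (u + c - x_j)`. -/
noncomputable def twoPins (r : ℕ) (c : ℤ) : LaurentSeries (End (str k r)) :=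
  pinSeries k r (elemGen k r c) * pinSeries k r (compGen k r)

end ASchur

end DegAffSchur

open DegAffSchur DegAffSchur.ASchur

/-!
The left-hand sides send the generator `m` of the module of `(a + b)` to `m f Y`, where `f` is the
series carried by the pin and `Y` is the sum of the shuffles, the minimal length representatives
of the cosets `(S_a × S_b) \ S_{a+b}`. Put `z_j = u - x_j`. The product of all `z_j` is symmetric,
hence commutes with `Y`, so `f` may be replaced by a product of factors `z_j` times the symmetric
series `h_{a+b}(u)`: the pin `h_a(u)` on the left string gives `∏_{j>a} z_j`, and the pin `h_b(u)`
on the right string gives `∏_{j≤a} z_j`.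

The sum `Y` satisfies a Pascal recursion (`shuffleSum_succ_succ`): the last letter either stays
where it is or is moved into the initial block by a cycle of basic transpositions. Since `m s_i =
m`, moving such a cycle to the left past the factors has a simple effect: a single factor picks up
`-1` at each step (`IsHeckeFamily.slide_one`), and a product of factors in the letters shifted by
the cycle is translated by `u ↦ u + 1` (`IsHeckeFamily.slide_prod`). Hence `m ∏ z_j Y` satisfies a
recursion without denominators, which is the Leibniz rule for the divided finite differences `Δ^a
/ a!` and `∇^b / b!` of `e_{a+b}(u) = ∏ z_j`; these are `fwdDiffProd` and `bwdDiffProd`, and the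
lemmas `IsHeckeFamily.prod_mul_shuffleSum_fwd` and `IsHeckeFamily.prod_mul_shuffleSum_bwd` carry
this out over any `k`. Multiplied by the factorial, the differences become the alternating sums of
the statement (`factorial_mul_fwdDiffProd`, `factorial_mul_bwdDiffProd`).

As the recursions make sense over `ℤ` and are compatible with base change, torsion-freeness of the
integral polynomial ring gives the uniqueness of the quotient by the factorial and the symmetry of
its coefficients (`divided_identity`).
-/

namespace DegAffSchur

/-! ### Shuffles as explicit products of basic transpositions -/

/-- The basic transposition of the letters `i` and `i + 1` among `0, …, n - 1`, and the identity
if `i + 1` is not a letter. -/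
def adjSwap (n i : ℕ) : Equiv.Perm (Fin n) :=
  if h : i + 1 < n then Equiv.swap ⟨i, by omega⟩ ⟨i + 1, h⟩ else 1

theorem adjSwap_val {n i : ℕ} (h : i + 1 < n) (j : Fin n) :
    (adjSwap n i j : ℕ) = if (j : ℕ) = i then i + 1 else if (j : ℕ) = i + 1 then i else j := by
  simp only [adjSwap, dif_pos h, Equiv.swap_apply_def, Fin.ext_iff]
  split_ifs <;> rfl

/-- The cycle `s_i s_{i+1} ⋯ s_{i+m-1}`, which moves the letter `i + m` down to `i`. -/
def adjCycle (n i : ℕ) : ℕ → Equiv.Perm (Fin n)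
  | 0 => 1
  | m + 1 => adjCycle n i m * adjSwap n (i + m)

theorem adjCycle_val {n i m : ℕ} (h : i + m < n) (j : Fin n) :
    (adjCycle n i m j : ℕ) =
      if (j : ℕ) = i + m then i else if i ≤ (j : ℕ) ∧ (j : ℕ) < i + m then j + 1 else j := by
  induction m generalizing j with
  | zero => simp only [adjCycle, Equiv.Perm.one_apply]; split_ifs <;> omega
  | succ m ih =>
    rw [adjCycle, Equiv.Perm.mul_apply, ih (by omega), adjSwap_val (by omega)]
    split_ifs <;> omega

/-- The minimal length permutation of the letters below `r` which maps `A`, in increasing order,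
to the initial letters and the remaining letters below `r`, in increasing order, to the following
ones. Only the part of `A` below `r` matters. -/
def shuffle (n : ℕ) : ℕ → Finset ℕ → Equiv.Perm (Fin n)
  | 0, _ => 1
  | r + 1, A =>
    if r ∈ A then
      adjCycle n (A.filter (· < r)).card (r - (A.filter (· < r)).card) * shuffle n r A
    else shuffle n r A

theorem card_filter_lt_le (A : Finset ℕ) (r : ℕ) : (A.filter (· < r)).card ≤ r := by
  calc _ ≤ (Finset.range r).card := Finset.card_le_card fun x hx => by simp_all
    _ = r := Finset.card_range r

theorem filter_lt_succ_of_mem {A : Finset ℕ} {r : ℕ} (h : r ∈ A) :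
    (A.filter (· < r + 1)).card = (A.filter (· < r)).card + 1 := by
  rw [← Finset.card_insert_of_notMem (a := r) (by simp)]
  congr 1
  ext x
  simp only [Finset.mem_filter, Finset.mem_insert]
  constructor
  · rintro ⟨h1, h2⟩
    rcases Nat.lt_succ_iff_lt_or_eq.1 h2 with h3 | h3
    · exact Or.inr ⟨h1, h3⟩
    · exact Or.inl h3
  · rintro (rfl | ⟨h1, h2⟩)
    · exact ⟨h, by omega⟩
    · exact ⟨h1, by omega⟩

theorem filter_lt_succ_of_notMem {A : Finset ℕ} {r : ℕ} (h : r ∉ A) :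
    A.filter (· < r + 1) = A.filter (· < r) := by
  ext x
  simp only [Finset.mem_filter]
  refine and_congr_right fun hx => ⟨fun h2 => ?_, fun h2 => by omega⟩
  have : x ≠ r := by rintro rfl; exact h hx
  omega

theorem shuffle_val_of_le {n r : ℕ} (hr : r ≤ n) (A : Finset ℕ) (j : Fin n) (hj : r ≤ (j : ℕ)) :
    shuffle n r A j = j := by
  induction r with
  | zero => rfl
  | succ r ih =>
    have h1 := ih (by omega) (by omega)
    have h2 := card_filter_lt_le A r
    rw [shuffle]
    split_ifs
    · rw [Equiv.Perm.mul_apply, h1]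
      refine Fin.ext ?_
      rw [adjCycle_val (by omega)]
      split_ifs <;> omega
    · exact h1

theorem shuffle_val_lt_iff {n r : ℕ} (hr : r ≤ n) (A : Finset ℕ) (j : Fin n) (hj : (j : ℕ) < r) :
    (shuffle n r A j : ℕ) < r ∧
      ((shuffle n r A j : ℕ) < (A.filter (· < r)).card ↔ (j : ℕ) ∈ A) := by
  induction r with
  | zero => omega
  | succ r ih =>
    have h2 := card_filter_lt_le A r
    by_cases hA : r ∈ A
    · rw [shuffle, if_pos hA, Equiv.Perm.mul_apply, adjCycle_val (by omega),
        filter_lt_succ_of_mem hA]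
      rcases Nat.lt_succ_iff_lt_or_eq.1 hj with h3 | h3
      · obtain ⟨h4, h5⟩ := ih (by omega) h3
        rw [← h5]
        split_ifs <;> omega
      · rw [shuffle_val_of_le (by omega) A j h3.ge]
        rw [← h3] at hA
        simp only [hA, iff_true]
        split_ifs <;> omega
    · rw [shuffle, if_neg hA, filter_lt_succ_of_notMem hA]
      rcases Nat.lt_succ_iff_lt_or_eq.1 hj with h3 | h3
      · obtain ⟨h4, h5⟩ := ih (by omega) h3
        exact ⟨by omega, h5⟩
      · rw [shuffle_val_of_le (by omega) A j h3.ge]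
        rw [← h3] at hA
        simp only [hA, iff_false]
        omega

theorem shuffle_insert (n r l : ℕ) (hl : r ≤ l) (A : Finset ℕ) :
    shuffle n r (insert l A) = shuffle n r A := by
  induction r with
  | zero => rfl
  | succ r ih =>
    have h1 : (insert l A).filter (· < r) = A.filter (· < r) := by
      rw [Finset.filter_insert, if_neg (by omega)]
    have h2 : r ∈ insert l A ↔ r ∈ A := by
      rw [Finset.mem_insert, or_iff_right (by omega)]
    simp only [shuffle, h1, h2, ih (by omega)]

section Sum

variable {B : Type*} [Ring B] {n : ℕ} (t : Equiv.Perm (Fin n) →* B)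

/-- The sum of the images of the minimal length representatives of the right cosets of
`S_a × S_{r-a}` in `S_r`; it is zero for `a > r`. -/
def shuffleSum (a r : ℕ) : B :=
  ∑ A ∈ (Finset.range r).powersetCard a, t (shuffle n r A)

theorem shuffleSum_zero_left (r : ℕ) : shuffleSum t 0 r = 1 := by
  have : ∀ r, shuffle n r ∅ = 1 := by
    intro r
    induction r with
    | zero => rfl
    | succ r ih => rw [shuffle, if_neg (by simp), ih]
  simp [shuffleSum, this]

theorem shuffleSum_eq_zero {a r : ℕ} (h : r < a) : shuffleSum t a r = 0 := by
  rw [shuffleSum, Finset.powersetCard_eq_empty.2 (by simpa using h), Finset.sum_empty]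

/-- Pascal recursion: the letter `r` either stays or is moved into the initial block. -/
theorem shuffleSum_succ_succ (a r : ℕ) :
    shuffleSum t (a + 1) (r + 1) =
      shuffleSum t (a + 1) r + t (adjCycle n a (r - a)) * shuffleSum t a r := by
  have hr : ∀ (c : ℕ), ∀ A ∈ (Finset.range r).powersetCard c, r ∉ A := by
    intro c A hA h
    simpa using (Finset.mem_powersetCard.1 hA).1 h
  rw [shuffleSum, Finset.range_add_one, Finset.powersetCard_succ_insert (by simp),
    Finset.sum_union, Finset.sum_image]
  · congr 1
    · exact Finset.sum_congr rfl fun A hA => by rw [shuffle, if_neg (hr _ A hA)]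
    -- the sets containing `r`: `a` of the letters below `r` are already in the initial block
    · rw [shuffleSum, Finset.mul_sum]
      refine Finset.sum_congr rfl fun A hA => ?_
      have hc : ((insert r A).filter (· < r)).card = a := by
        rw [Finset.filter_insert, if_neg (by omega), Finset.filter_true_of_mem,
          (Finset.mem_powersetCard.1 hA).2]
        exact fun x hx => by simpa using (Finset.mem_powersetCard.1 hA).1 hx
      rw [shuffle, if_pos (Finset.mem_insert_self r A), hc, shuffle_insert _ _ _ le_rfl, map_mul]
  · intro A hA A' hA' h
    have := congrArg (Finset.erase · r) h
    simpa [Finset.erase_insert (hr _ A hA), Finset.erase_insert (hr _ A' hA')] using this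
  · rw [Finset.disjoint_left]
    intro A hA hA'
    obtain ⟨A', -, rfl⟩ := Finset.mem_image.1 hA'
    exact hr _ _ hA (Finset.mem_insert_self r A')

/-- An element commuting with the basic transpositions of the letters below `r` commutes with
the sum of coset representatives. -/
theorem commute_shuffleSum {p : B} {r : ℕ} (a : ℕ)
    (hp : ∀ i, i + 1 < r → Commute p (t (adjSwap n i))) : Commute p (shuffleSum t a r) := by
  have hcyc : ∀ i m, i + m < r → Commute p (t (adjCycle n i m)) := by
    intro i m
    induction m with
    | zero => intro _; simp [adjCycle]
    | succ m ih =>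
      intro h
      rw [adjCycle, map_mul]
      exact (ih (by omega)).mul_right (hp _ (by omega))
  have key : ∀ r' ≤ r, ∀ A, Commute p (t (shuffle n r' A)) := by
    intro r'
    induction r' with
    | zero => intro _ A; simp [shuffle]
    | succ r' ih =>
      intro hr' A
      have h2 := card_filter_lt_le A r'
      rw [shuffle]
      split_ifs
      · rw [map_mul]
        exact (hcyc _ _ (by omega)).mul_right (ih (by omega) A)
      · exact ih (by omega) A
  exact Commute.sum_right _ _ _ fun A _ => key r le_rfl A

end Sum

/-! ### The recursions satisfied by finite differences of `∏ z_j` -/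

section Recursion

variable {R : Type*} [CommRing R]

/-- The divided difference `(1/a!) Δ^a` of `c ↦ ∏_{j<r} (z_j + c)` at `c = 0`, for forward
differences `Δ` with step one, given by a recursion that needs no division. -/
def fwdDiffProd : ℕ → ℕ → (ℕ → R) → R
  | 0, r, z => ∏ j ∈ Finset.range r, z j
  | _ + 1, 0, _ => 0
  | a + 1, r + 1, z => z r * fwdDiffProd (a + 1) r z + fwdDiffProd a r (fun j => z j + 1)

/-- The divided difference `(1/b!) ∇^b` of `c ↦ ∏_{j<r} (z_j + c)` at `c = 0`, for backward
differences `∇` with step one, given by a recursion that needs no division. -/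
def bwdDiffProd (z : ℕ → R) : ℕ → ℕ → R
  | 0, r => ∏ j ∈ Finset.range r, z j
  | _ + 1, 0 => 0
  | b + 1, r + 1 => bwdDiffProd z b r + (z r - (b + 1 : ℕ)) * bwdDiffProd z (b + 1) r

theorem fwdDiffProd_eq_zero {a r : ℕ} (h : r < a) (z : ℕ → R) : fwdDiffProd a r z = 0 := by
  induction r generalizing a z with
  | zero => obtain ⟨a, rfl⟩ := Nat.exists_eq_succ_of_ne_zero h.ne'; rw [fwdDiffProd]
  | succ r ih =>
    obtain ⟨a, rfl⟩ := Nat.exists_eq_succ_of_ne_zero (by omega : a ≠ 0)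
    rw [fwdDiffProd, ih (by omega), ih (by omega), mul_zero, add_zero]

theorem bwdDiffProd_eq_zero {b r : ℕ} (h : r < b) (z : ℕ → R) : bwdDiffProd z b r = 0 := by
  induction r generalizing b with
  | zero => obtain ⟨b, rfl⟩ := Nat.exists_eq_succ_of_ne_zero h.ne'; rw [bwdDiffProd]
  | succ r ih =>
    obtain ⟨b, rfl⟩ := Nat.exists_eq_succ_of_ne_zero (by omega : b ≠ 0)
    rw [bwdDiffProd, ih (by omega), ih (by omega), mul_zero, add_zero]

theorem bwdDiffProd_self (b : ℕ) (z : ℕ → R) : bwdDiffProd z b b = 1 := by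
  induction b with
  | zero => simp [bwdDiffProd]
  | succ b ih => rw [bwdDiffProd, ih, bwdDiffProd_eq_zero (by omega), mul_zero, add_zero]

theorem map_fwdDiffProd {S : Type*} [CommRing S] (f : R →+* S) (a r : ℕ) (z : ℕ → R) :
    f (fwdDiffProd a r z) = fwdDiffProd a r (fun j => f (z j)) := by
  induction r generalizing a z with
  | zero => cases a <;> simp [fwdDiffProd]
  | succ r ih => cases a <;> simp [fwdDiffProd, ih]

theorem map_bwdDiffProd {S : Type*} [CommRing S] (f : R →+* S) (b r : ℕ) (z : ℕ → R) :
    f (bwdDiffProd z b r) = bwdDiffProd (fun j => f (z j)) b r := by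
  induction r generalizing b with
  | zero => cases b <;> simp [bwdDiffProd]
  | succ r ih => cases b <;> simp [bwdDiffProd, ih]

theorem factorial_mul_fwdDiffProd (a r : ℕ) (z : ℕ → R) :
    (a.factorial : R) * fwdDiffProd a r z = ∑ i ∈ Finset.range (a + 1),
      (-1) ^ (a - i) * (a.choose i : R) * ∏ j ∈ Finset.range r, (z j + i) := by
  induction r generalizing a z with
  | zero =>
    cases a with
    | zero => simp [fwdDiffProd]
    | succ a =>
      have h := add_pow (1 : R) (-1) (a + 1)
      simp only [add_neg_cancel, ne_eq, Nat.succ_ne_zero, not_false_eq_true, zero_pow,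
        one_pow, one_mul] at h
      simp [fwdDiffProd, ← h]
  | succ r ih =>
    cases a with
    | zero => simp [fwdDiffProd]
    | succ a =>
      have h1 := ih (a + 1) z
      have h2 := ih a (fun j => z j + 1)
      rw [fwdDiffProd, mul_add, mul_left_comm, h1, Nat.factorial_succ, Nat.cast_mul, mul_assoc, h2]
      simp only [Finset.prod_range_succ]
      have h3 : ∀ i ∈ Finset.range (a + 1 + 1),
          (-1) ^ (a + 1 - i) * ((a + 1).choose i : R) *
            ((∏ j ∈ Finset.range r, (z j + (i : R))) * (z r + i)) =
          z r * ((-1) ^ (a + 1 - i) * ((a + 1).choose i : R) *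
            ∏ j ∈ Finset.range r, (z j + (i : R))) +
          (-1) ^ (a + 1 - i) * ((i * (a + 1).choose i : ℕ) : R) *
            ∏ j ∈ Finset.range r, (z j + (i : R)) := by
        intro i _; push_cast; ring
      rw [Finset.sum_congr rfl h3, Finset.sum_add_distrib, ← Finset.mul_sum]
      congr 1
      rw [Finset.sum_range_succ' _ (a + 1), Finset.mul_sum]
      simp only [zero_mul, Nat.cast_zero, mul_zero, add_zero]
      refine Finset.sum_congr rfl fun i _ => ?_
      rw [show (i + 1) * (a + 1).choose (i + 1) = (a + 1) * a.choose i by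
        rw [Nat.add_one_mul_choose_eq, mul_comm], Nat.add_sub_add_right]
      have h4 : ∀ j, z j + 1 + (i : R) = z j + ((i + 1 : ℕ) : R) := fun j => by push_cast; ring
      simp only [h4]
      push_cast; ring

theorem factorial_mul_bwdDiffProd (b r : ℕ) (z : ℕ → R) :
    (b.factorial : R) * bwdDiffProd z b r = ∑ i ∈ Finset.range (b + 1),
      (-1) ^ i * (b.choose i : R) * ∏ j ∈ Finset.range r, (z j - i) := by
  induction r generalizing b with
  | zero =>
    cases b with
    | zero => simp [bwdDiffProd]
    | succ b =>
      have h := add_pow (-1 : R) 1 (b + 1)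
      simp only [neg_add_cancel, ne_eq, Nat.succ_ne_zero, not_false_eq_true, zero_pow,
        one_pow, mul_one] at h
      simp [bwdDiffProd, ← h]
  | succ r ih =>
    cases b with
    | zero => simp [bwdDiffProd]
    | succ b =>
      have h1 := ih (b + 1)
      have h2 := ih b
      rw [bwdDiffProd, mul_add, mul_left_comm, h1, Nat.factorial_succ, Nat.cast_mul, mul_assoc, h2]
      simp only [Finset.prod_range_succ _ r]
      have h3 : ∀ i ∈ Finset.range (b + 1 + 1),
          (-1) ^ i * ((b + 1).choose i : R) *
            ((∏ j ∈ Finset.range r, (z j - (i : R))) * (z r - i)) =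
          (-1) ^ i * (((b + 1).choose i * (b + 1 - i) : ℕ) : R) *
            (∏ j ∈ Finset.range r, (z j - (i : R))) +
          (z r - (b + 1 : ℕ)) * ((-1) ^ i * ((b + 1).choose i : R) *
            ∏ j ∈ Finset.range r, (z j - (i : R))) := by
        intro i hi
        rw [Finset.mem_range] at hi
        rw [Nat.cast_mul, Nat.cast_sub (by omega)]
        push_cast; ring
      rw [Finset.sum_congr rfl h3, Finset.sum_add_distrib, ← Finset.mul_sum]
      congr 1
      rw [Finset.sum_range_succ _ (b + 1), Finset.mul_sum]
      simp only [Nat.sub_self, mul_zero, Nat.cast_zero, zero_mul, add_zero]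
      refine Finset.sum_congr rfl fun i hi => ?_
      rw [Finset.mem_range] at hi
      rw [show (b + 1).choose i * (b + 1 - i) = (b + 1) * b.choose i by
        rw [← Nat.choose_mul_succ_eq, mul_comm]]
      push_cast; ring

end Recursion

/-! ### Moving products of linear factors past shuffles -/

section Slide

variable {n : ℕ} {R B N : Type*} [CommRing R] [Ring B] [AddCommGroup N]

/-- The relations of the degenerate affine Hecke algebra between the basic transpositions and a
sequence of commuting elements `z_j = u - x_j`, in terms of a map `ι` from a commutative ring
containing the `z_j`. -/
structure IsHeckeFamily (ι : R →+* B) (t : Equiv.Perm (Fin n) →* B) (z : ℕ → R) : Prop where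
  mul_adjSwap : ∀ i, i + 1 < n →
    ι (z i) * t (adjSwap n i) = t (adjSwap n i) * ι (z (i + 1)) - 1
  commute : ∀ l i, l ≠ i → l ≠ i + 1 → Commute (ι (z l)) (t (adjSwap n i))

/-- An additive map whose kernel is a right ideal containing all `w - 1` for `w` in the symmetric
group. -/
structure IsTrivialInduced (t : Equiv.Perm (Fin n) →* B) (π : B →+ N) : Prop where
  perm_mul : ∀ w c, π (t w * c) = π c
  mul_right : ∀ p q c, π p = π q → π (p * c) = π (q * c)

theorem adjSwap_mul_self (n i : ℕ) : adjSwap n i * adjSwap n i = 1 := by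
  unfold adjSwap
  split_ifs <;> simp

namespace IsHeckeFamily

variable {ι : R →+* B} {t : Equiv.Perm (Fin n) →* B} {z : ℕ → R}

theorem succ_mul_adjSwap (hz : IsHeckeFamily ι t z) (i : ℕ) (hi : i + 1 < n) :
    ι (z (i + 1)) * t (adjSwap n i) = t (adjSwap n i) * ι (z i) + 1 := by
  have hs : t (adjSwap n i) * t (adjSwap n i) = 1 := by
    rw [← map_mul, adjSwap_mul_self, map_one]
  have h := congrArg (fun p => t (adjSwap n i) * p * t (adjSwap n i)) (hz.mul_adjSwap i hi)
  simp only [mul_sub, sub_mul, mul_one, mul_assoc, hs] at h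
  rw [← mul_assoc, hs, one_mul] at h
  rw [h, sub_add_cancel]

theorem add_one (hz : IsHeckeFamily ι t z) : IsHeckeFamily ι t (fun j => z j + 1) where
  mul_adjSwap i hi := by
    rw [map_add, map_one, add_mul, hz.mul_adjSwap i hi, map_add, map_one]
    noncomm_ring
  commute l i h1 h2 := by
    rw [map_add, map_one]
    exact (hz.commute l i h1 h2).add_left (Commute.one_left _)

theorem commute_prod (hz : IsHeckeFamily ι t z) (s : Finset ℕ) (i : ℕ) (h1 : i ∉ s)
    (h2 : i + 1 ∉ s) : Commute (ι (∏ j ∈ s, z j)) (t (adjSwap n i)) := by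
  refine Finset.prod_induction _ (fun p => Commute (ι p) (t (adjSwap n i))) ?_ ?_ ?_
  · intro p q hp hq; rw [map_mul]; exact hp.mul_left hq
  · rw [map_one]; exact Commute.one_left _
  · intro j hj
    exact hz.commute j i (fun e => h1 (e ▸ hj)) (fun e => h2 (e ▸ hj))

theorem commute_adjCycle (hz : IsHeckeFamily ι t z) (l i m : ℕ) (h : i + m < l) :
    Commute (ι (z l)) (t (adjCycle n i m)) := by
  induction m with
  | zero => simp [adjCycle]
  | succ m ih =>
    rw [adjCycle, map_mul]
    exact (ih (by omega)).mul_right (hz.commute _ _ (by omega) (by omega))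

variable {π : B →+ N}

/-- Modulo the right ideal, a linear factor moved along a cycle picks up `-1` at each step. -/
theorem slide_one (hz : IsHeckeFamily ι t z) (hπ : IsTrivialInduced t π) (i m : ℕ)
    (him : i + m < n) (q : R) (hq : ∀ j, i ≤ j → Commute (ι q) (t (adjSwap n j))) (c : B) :
    π (ι (q * z i) * (t (adjCycle n i m) * c)) = π (ι (q * (z (i + m) - m)) * c) := by
  induction m generalizing c with
  | zero => simp [adjCycle]
  | succ m ih =>
    rw [adjCycle, map_mul t, mul_assoc, ih (by omega)]
    set s := t (adjSwap n (i + m))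
    have hs : ι (z (i + m)) * s = s * ι (z (i + m + 1)) - 1 := hz.mul_adjSwap _ (by omega)
    have hqs : ι q * s = s * ι q := (hq (i + m) (by omega)).eq
    have e : ι (q * (z (i + m) - m)) * (s * c) =
        s * (ι (q * (z (i + m + 1) - m)) * c) - ι q * c := by
      simp only [map_mul, map_sub, map_natCast]
      calc _ = ι q * ((ι (z (i + m)) * s) * c) - ι q * ((m : B) * s * c) := by noncomm_ring
        _ = (ι q * s) * (ι (z (i + m + 1)) * c) - ι q * c - (ι q * s) * ((m : B) * c) := by
          rw [hs, (Nat.cast_commute m s).eq]; noncomm_ring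
        _ = _ := by rw [hqs]; noncomm_ring
    rw [e, map_sub, hπ.perm_mul, ← map_sub, ← sub_mul, ← map_sub]
    congr 3
    push_cast
    rw [add_assoc]
    ring

/-- Modulo the right ideal, a cycle moved past the linear factors in the letters which it shifts
lowers their indices by one and raises the variable `u` by one. -/
theorem slide_prod (hz : IsHeckeFamily ι t z) (hπ : IsTrivialInduced t π) (i m : ℕ)
    (him : i + m < n) (c : B) :
    π (ι (∏ j ∈ Finset.Ico (i + 1) (i + m + 1), z j) * (t (adjCycle n i m) * c)) =
      π (ι (∏ j ∈ Finset.Ico i (i + m), (z j + 1)) * c) := by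
  induction m generalizing c with
  | zero => simp [adjCycle]
  | succ m ih =>
    rw [adjCycle, map_mul t, ← add_assoc, Finset.prod_Ico_succ_top (by omega : i + 1 ≤ i + m + 1),
      Finset.prod_Ico_succ_top (by omega : i ≤ i + m)]
    have ih := ih (by omega)
    set P := ∏ j ∈ Finset.Ico (i + 1) (i + m + 1), z j
    set Q := ∏ j ∈ Finset.Ico i (i + m), (z j + 1)
    set s := t (adjSwap n (i + m))
    have h1 := (hz.commute_adjCycle (i + m + 1) i m (by omega)).eq
    have h2 : ι (z (i + m + 1)) * s = s * ι (z (i + m)) + 1 :=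
      hz.succ_mul_adjSwap _ (by omega)
    have h3 : ι Q * s = s * ι Q :=
      (hz.add_one.commute_prod (Finset.Ico i (i + m)) (i + m) (by simp) (by simp)).eq
    have e1 : ι (P * z (i + m + 1)) * (t (adjCycle n i m) * s * c) =
        ι P * (t (adjCycle n i m) * (s * (ι (z (i + m)) * c) + c)) := by
      calc _ = ι P * ((ι (z (i + m + 1)) * t (adjCycle n i m)) * s * c) := by
            rw [map_mul]; noncomm_ring
        _ = ι P * (t (adjCycle n i m) * ((ι (z (i + m + 1)) * s) * c)) := by
            rw [h1]; noncomm_ring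
        _ = _ := by rw [h2]; noncomm_ring
    have e2 : ι Q * (s * (ι (z (i + m)) * c) + c) = s * (ι Q * (ι (z (i + m)) * c)) + ι Q * c := by
      rw [mul_add, ← mul_assoc, h3, mul_assoc]
    rw [e1, ih, e2, map_add, hπ.perm_mul, ← map_add, map_mul ι, map_add ι, map_one]
    congr 1
    noncomm_ring

/-- Summing the product of the linear factors outside the initial block over all cosets gives a
divided forward difference. -/
theorem prod_mul_shuffleSum_fwd (hz : IsHeckeFamily ι t z) (hπ : IsTrivialInduced t π)
    (r : ℕ) (hr : r ≤ n) (a : ℕ) :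
    π (ι (∏ j ∈ Finset.Ico a r, z j) * shuffleSum t a r) = π (ι (fwdDiffProd a r z)) := by
  induction r generalizing a z with
  | zero =>
    cases a with
    | zero => simp [shuffleSum_zero_left, fwdDiffProd]
    | succ a => rw [shuffleSum_eq_zero t (by omega), fwdDiffProd, map_zero, mul_zero]
  | succ r ih =>
    cases a with
    | zero => simp [shuffleSum_zero_left, fwdDiffProd]
    | succ a =>
      rcases lt_or_ge r a with h | h
      · rw [shuffleSum_eq_zero t (by omega), fwdDiffProd_eq_zero (by omega), map_zero, mul_zero]
      have hcomm : Commute (ι (z r)) (shuffleSum t (a + 1) r) :=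
        commute_shuffleSum t _ fun i hi => hz.commute _ _ (by omega) (by omega)
      have h1 : π (ι (∏ j ∈ Finset.Ico (a + 1) (r + 1), z j) * shuffleSum t (a + 1) r) =
          π (ι (z r * fwdDiffProd (a + 1) r z)) := by
        rcases eq_or_lt_of_le h with rfl | h
        · rw [shuffleSum_eq_zero t (by omega), fwdDiffProd_eq_zero (by omega), mul_zero, mul_zero,
            map_zero, map_zero, map_zero]
        · rw [Finset.prod_Ico_succ_top (by omega), map_mul ι, mul_assoc, hcomm.eq, ← mul_assoc,
            hπ.mul_right _ _ _ (ih hz (by omega) (a + 1)), ← map_mul, mul_comm]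
      obtain ⟨m, rfl⟩ := Nat.exists_eq_add_of_le h
      -- the terms in which the letter `r` moves are translates: the induction is over all `z`
      rw [shuffleSum_succ_succ, mul_add, map_add, h1, Nat.add_sub_cancel_left,
        hz.slide_prod hπ a m (by omega), ih hz.add_one (by omega) a, ← map_add, ← map_add,
        fwdDiffProd]

/-- Summing the product of the linear factors in the initial block over all cosets gives a
divided backward difference. -/
theorem prod_mul_shuffleSum_bwd (hz : IsHeckeFamily ι t z) (hπ : IsTrivialInduced t π)
    (a b r : ℕ) (hab : a + b = r) (hr : r ≤ n) :
    π (ι (∏ j ∈ Finset.range a, z j) * shuffleSum t a r) = π (ι (bwdDiffProd z b r)) := by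
  induction r generalizing a b with
  | zero =>
    obtain ⟨rfl, rfl⟩ : a = 0 ∧ b = 0 := by omega
    simp [shuffleSum_zero_left, bwdDiffProd]
  | succ r ih =>
    cases a with
    | zero =>
      obtain rfl : b = r + 1 := by omega
      simp [shuffleSum_zero_left, bwdDiffProd_self]
    | succ a =>
      have hcomm : Commute (ι (z r - b)) (shuffleSum t a r) := by
        rw [map_sub, map_natCast]
        exact Commute.sub_left
          (commute_shuffleSum t _ fun i hi => hz.commute _ _ (by omega) (by omega))
          (Nat.cast_commute b _)
      have hq : ∀ j, a ≤ j → Commute (ι (∏ j ∈ Finset.range a, z j)) (t (adjSwap n j)) :=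
        fun j hj => hz.commute_prod _ j (by simpa using hj) (by simp; omega)
      have h1 : ι ((∏ j ∈ Finset.range a, z j) * (z r - b)) * shuffleSum t a r =
          ι (∏ j ∈ Finset.range a, z j) * shuffleSum t a r * ι (z r - b) := by
        rw [map_mul, mul_assoc, hcomm.eq, mul_assoc]
      have h2 := hz.slide_one hπ a b (by omega) _ hq (shuffleSum t a r)
      rw [show a + b = r by omega, h1,
        hπ.mul_right _ _ _ (ih a b (by omega) (by omega)), ← map_mul] at h2
      rw [shuffleSum_succ_succ, mul_add, map_add, Finset.prod_range_succ,
        show r - a = b by omega, h2, ← Finset.prod_range_succ]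
      cases b with
      | zero =>
        obtain rfl : a = r := by omega
        rw [shuffleSum_eq_zero t (by omega), mul_zero, map_zero, zero_add]
        simp [bwdDiffProd, Finset.prod_range_succ]
      | succ b =>
        rw [ih (a + 1) b (by omega) (by omega), ← map_add, ← map_add, bwdDiffProd,
          mul_comm (z r - _)]

end IsHeckeFamily

end Slide

/-! ### Laurent series over the degenerate affine Hecke algebra -/

section Series

variable (k : Type u) [CommRing k] (n : ℕ)

/-- The map `ofPoly` on coefficients of Laurent series. -/
noncomputable def ofPolySeries :
    LaurentSeries (MvPolynomial (Fin n) k) →+* LaurentSeries (AH k n) where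
  toFun F := F.map (ofPoly k n)
  map_one' := HahnSeries.map_one (ofPoly k n).toRingHom.toMonoidWithZeroHom
  map_mul' _ _ := HahnSeries.map_mul (ofPoly k n).toRingHom.toNonUnitalRingHom
  map_zero' := HahnSeries.map_zero (ofPoly k n).toRingHom.toAddMonoidHom.toZeroHom
  map_add' _ _ := HahnSeries.map_add (ofPoly k n).toRingHom.toAddMonoidHom

theorem coeff_ofPolySeries (F : LaurentSeries (MvPolynomial (Fin n) k)) (m : ℤ) :
    (ofPolySeries k n F).coeff m = ofPoly k n (F.coeff m) := rfl

/-- Permutations as constant Laurent series. -/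
noncomputable def permSeries : Equiv.Perm (Fin n) →* LaurentSeries (AH k n) :=
  (HahnSeries.C : AH k n →+* LaurentSeries (AH k n)).toMonoidHom.comp (tgen k)

theorem permSeries_apply (w : Equiv.Perm (Fin n)) :
    permSeries k n w = HahnSeries.C (tgen k w) := rfl

/-- The linear factor `u - x_j`, letters being counted from `0`, with value zero if `j` is not a
letter. -/
noncomputable def linFactor (j : ℕ) : LaurentSeries (MvPolynomial (Fin n) k) :=
  if h : j < n then HahnSeries.single (-1 : ℤ) 1 - HahnSeries.C (X ⟨j, h⟩) else 0

theorem ofPolySeries_linFactor {j : ℕ} (h : j < n) :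
    ofPolySeries k n (linFactor k n j) =
      HahnSeries.single (-1 : ℤ) 1 - HahnSeries.C (xgen k ⟨j, h⟩) := by
  rw [linFactor, dif_pos h, map_sub]
  congr 1
  · ext m
    rw [coeff_ofPolySeries, HahnSeries.coeff_single, HahnSeries.coeff_single]
    split_ifs <;> simp
  · ext m
    rw [coeff_ofPolySeries, HahnSeries.C_apply, HahnSeries.C_apply, HahnSeries.coeff_single,
      HahnSeries.coeff_single]
    split_ifs <;> simp

theorem commute_single_C {A : Type*} [Ring A] (a : A) (m : ℤ) :
    Commute (HahnSeries.single m (1 : A)) (HahnSeries.C a) := by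
  change _ * _ = _ * _
  rw [HahnSeries.C_apply, HahnSeries.single_mul_single, HahnSeries.single_mul_single]
  simp

theorem linear_mul_C {A : Type*} [Ring A] {a b s : A} (h : a * s = s * b + 1) :
    (HahnSeries.single (-1 : ℤ) (1 : A) - HahnSeries.C a) * HahnSeries.C s =
      HahnSeries.C s * (HahnSeries.single (-1 : ℤ) 1 - HahnSeries.C b) - 1 := by
  rw [sub_mul, mul_sub, (commute_single_C _ _).eq, ← map_mul, ← map_mul, h, map_add,
    map_one HahnSeries.C, sub_sub]

theorem linear_commute_C {A : Type*} [Ring A] {a s : A} (h : Commute a s) :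
    Commute (HahnSeries.single (-1 : ℤ) (1 : A) - HahnSeries.C a) (HahnSeries.C s) :=
  (commute_single_C _ _).sub_left (h.map HahnSeries.C)

theorem isHeckeFamily_linFactor :
    IsHeckeFamily (B := LaurentSeries (AH k n)) (ofPolySeries k n) (permSeries k n)
      (linFactor k n) where
  mul_adjSwap i hi := by
    rw [ofPolySeries_linFactor k n (by omega : i < n), ofPolySeries_linFactor k n hi,
      permSeries_apply, adjSwap, dif_pos hi]
    exact linear_mul_C (x_mul_s k ⟨i, by omega⟩ ⟨i + 1, hi⟩ rfl)
  commute l i h1 h2 := by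
    by_cases hi : i + 1 < n
    · by_cases hl : l < n
      · rw [ofPolySeries_linFactor k n hl, permSeries_apply, adjSwap, dif_pos hi]
        exact linear_commute_C (x_mul_s_far k ⟨l, hl⟩ ⟨i, by omega⟩ ⟨i + 1, hi⟩ rfl
          (by simpa [Fin.ext_iff]) (by simpa [Fin.ext_iff]))
      · rw [linFactor, dif_neg hl, map_zero]
        exact Commute.zero_left _
    · rw [adjSwap, dif_neg hi, map_one]
      exact Commute.one_right _

theorem prod_linFactor_add (c : ℤ) :
    ∏ j ∈ Finset.range n, (linFactor k n j + (c : LaurentSeries (MvPolynomial (Fin n) k))) =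
      elemPoly k n c := by
  rw [elemPoly, Finset.prod_range]
  refine Finset.prod_congr rfl fun j _ => ?_
  rw [linFactor, dif_pos j.2]
  ring

variable {k n}

theorem commute_permSeries (F : LaurentSeries (symmetricSubalgebra (Fin n) k))
    (w : Equiv.Perm (Fin n)) :
    Commute (permSeries k n w)
      (ofPolySeries k n (mapCoeff (symmetricSubalgebra (Fin n) k).val.toRingHom F)) := by
  change _ * _ = _ * _
  ext m
  rw [permSeries_apply, HahnSeries.C_apply, HahnSeries.coeff_single_zero_mul,
    HahnSeries.coeff_mul_single_zero]
  exact tgen_mul_ofPoly k (F.coeff m) w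

/-- The coefficients of a Laurent series over the degenerate affine Hecke algebra, applied to the
generator of the right module attached to a composition. -/
noncomputable def mvecSeries (lam : List ℕ) :
    LaurentSeries (AH k n) →+ (ℤ → AffM k n lam) where
  toFun F m := mvec lam (F.coeff m)
  map_zero' := rfl
  map_add' _ _ := rfl

theorem mvecSeries_apply (lam : List ℕ) (F : LaurentSeries (AH k n)) (m : ℤ) :
    mvecSeries lam F m = mvec lam (F.coeff m) := rfl

open MulOpposite in
theorem isTrivialInduced_mvecSeries :
    IsTrivialInduced (B := LaurentSeries (AH k n)) (N := ℤ → AffM k n [n]) (permSeries k n)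
      (mvecSeries [n]) where
  perm_mul w c := by
    funext m
    rw [mvecSeries_apply, permSeries_apply, HahnSeries.C_apply, HahnSeries.coeff_single_zero_mul]
    exact mvec_tgen _ _ (mem_young_single le_rfl w) _
  mul_right p q c h := by
    have e : (p - q) * c = p * c - q * c := sub_mul p q c
    -- equal images mean that all coefficients of `p - q` lie in the right ideal
    rw [← sub_eq_zero, ← map_sub, ← e]
    rw [← sub_eq_zero, ← map_sub] at h
    generalize p - q = p at h
    have h' : ∀ m, p.coeff m ∈ trivIdeal k n [n] := fun m =>
      (Submodule.Quotient.mk_eq_zero _).1 (congrFun h m)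
    funext m
    refine (Submodule.Quotient.mk_eq_zero _).2 ?_
    rw [HahnSeries.coeff_mul]
    exact Submodule.sum_mem _ fun ij _ => (trivIdeal k n [n]).smul_mem (op _) (h' _)

theorem shuffleSum_permSeries (a r : ℕ) :
    shuffleSum (B := LaurentSeries (AH k n)) (permSeries k n) a r =
      HahnSeries.C (shuffleSum (tgen k) a r) := by
  simp only [shuffleSum, map_sum, permSeries_apply]

theorem mapCoeff_val_compGen :
    mapCoeff (symmetricSubalgebra (Fin n) k).val.toRingHom (compGen k n) = compPoly k n := rfl

theorem mapCoeff_val_elemGen (c : ℤ) :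
    mapCoeff (symmetricSubalgebra (Fin n) k).val.toRingHom (elemGen k n c) = elemPoly k n c := rfl

theorem mul_compPoly_mul_shuffleSum (P : LaurentSeries (MvPolynomial (Fin n) k)) (a : ℕ) :
    ofPolySeries k n (P * compPoly k n) *
        shuffleSum (B := LaurentSeries (AH k n)) (permSeries k n) a n =
      ofPolySeries k n P * shuffleSum (B := LaurentSeries (AH k n)) (permSeries k n) a n *
        ofPolySeries k n (compPoly k n) := by
  have hc : Commute (shuffleSum (B := LaurentSeries (AH k n)) (permSeries k n) a n)
      (ofPolySeries k n (compPoly k n)) :=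
    Commute.sum_left _ _ _ fun A _ => commute_permSeries (compGen k n) _
  rw [map_mul, mul_assoc, ← hc.eq, mul_assoc]

theorem prod_linFactor_mul_compPoly :
    (∏ j ∈ Finset.range n, linFactor k n j) * compPoly k n = 1 := by
  have h := prod_linFactor_add k n 0
  simp only [Int.cast_zero, add_zero] at h
  rw [h, elemPoly_mul_compPoly]

/-- The inverse of the product of the linear factors in the initial block of size `a`, summed over
the cosets. -/
theorem mvec_mul_shuffleSum_fwd {a : ℕ} (ha : a ≤ n) (F : LaurentSeries (MvPolynomial (Fin n) k))
    (hF : F * ∏ j ∈ Finset.range a, linFactor k n j = 1) (m : ℤ) :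
    mvec [n] (ofPoly k n (F.coeff m) * shuffleSum (tgen k) a n) =
      mvec [n] (ofPoly k n ((fwdDiffProd a n (linFactor k n) * compPoly k n).coeff m)) := by
  have e : F = (∏ j ∈ Finset.Ico a n, linFactor k n j) * compPoly k n := by
    rw [← mul_one F, ← prod_linFactor_mul_compPoly (k := k) (n := n),
      ← Finset.prod_range_mul_prod_Ico _ ha, ← mul_assoc, ← mul_assoc, hF, one_mul]
  have h := (isTrivialInduced_mvecSeries (k := k) (n := n)).mul_right _ _
    (ofPolySeries k n (compPoly k n))
    ((isHeckeFamily_linFactor k n).prod_mul_shuffleSum_fwd isTrivialInduced_mvecSeries n le_rfl a)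
  rw [← mul_compPoly_mul_shuffleSum, ← e, ← map_mul, shuffleSum_permSeries] at h
  have h := congrFun h m
  rwa [mvecSeries_apply, mvecSeries_apply, HahnSeries.C_apply, HahnSeries.coeff_mul_single_zero]
    at h

/-- The inverse of the product of the linear factors in the final block of size `b`, summed over
the cosets. -/
theorem mvec_mul_shuffleSum_bwd {a b : ℕ} (hab : a + b = n)
    (F : LaurentSeries (MvPolynomial (Fin n) k))
    (hF : F * ∏ j ∈ Finset.Ico a n, linFactor k n j = 1) (m : ℤ) :
    mvec [n] (ofPoly k n (F.coeff m) * shuffleSum (tgen k) a n) =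
      mvec [n] (ofPoly k n ((bwdDiffProd (linFactor k n) b n * compPoly k n).coeff m)) := by
  have e : F = (∏ j ∈ Finset.range a, linFactor k n j) * compPoly k n := by
    rw [← mul_one F, ← prod_linFactor_mul_compPoly (k := k) (n := n),
      ← Finset.prod_range_mul_prod_Ico _ (by omega : a ≤ n), mul_comm (∏ j ∈ Finset.range a, _),
      mul_assoc, ← mul_assoc, hF, one_mul]
  have h := (isTrivialInduced_mvecSeries (k := k) (n := n)).mul_right _ _
    (ofPolySeries k n (compPoly k n))
    ((isHeckeFamily_linFactor k n).prod_mul_shuffleSum_bwd isTrivialInduced_mvecSeries a b n hab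
      le_rfl)
  rw [← mul_compPoly_mul_shuffleSum, ← e, ← map_mul, shuffleSum_permSeries] at h
  have h := congrFun h m
  rwa [mvecSeries_apply, mvecSeries_apply, HahnSeries.C_apply, HahnSeries.coeff_mul_single_zero]
    at h

theorem mapCoeff_compPoly_mul {R : Type*} [CommRing R] {a : ℕ} (f : MvPolynomial (Fin a) k →+* R) :
    mapCoeff f (compPoly k a) *
      ∏ j : Fin a, (HahnSeries.single (-1 : ℤ) 1 - HahnSeries.C (f (X j))) = 1 := by
  have h := congrArg (mapCoeff f) (elemPoly_mul_compPoly k a)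
  rw [map_mul, map_one, mul_comm, elemPoly, map_prod] at h
  rw [← h]
  congr 1
  refine Finset.prod_congr rfl fun j _ => ?_
  rw [Int.cast_zero, add_zero, map_sub, HahnSeries.C_apply, HahnSeries.C_apply, mapCoeff_single,
    mapCoeff_single, map_one f]

theorem mapCoeff_castAdd_compPoly_mul (a b : ℕ) :
    mapCoeff (rename (Fin.castAdd b) : _ →ₐ[k] MvPolynomial (Fin (a + b)) k).toRingHom
      (compPoly k a) * ∏ j ∈ Finset.range a, linFactor k (a + b) j = 1 := by
  rw [← mapCoeff_compPoly_mul (k := k)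
    (rename (Fin.castAdd b) : _ →ₐ[k] MvPolynomial (Fin (a + b)) k).toRingHom, Finset.prod_range]
  congr 1
  refine Finset.prod_congr rfl fun j _ => ?_
  rw [linFactor, dif_pos (by omega)]
  simp [Fin.castAdd, Fin.castLE]

theorem mapCoeff_natAdd_compPoly_mul (a b : ℕ) :
    mapCoeff (rename (Fin.natAdd a) : _ →ₐ[k] MvPolynomial (Fin (a + b)) k).toRingHom
      (compPoly k b) * ∏ j ∈ Finset.Ico a (a + b), linFactor k (a + b) j = 1 := by
  rw [← mapCoeff_compPoly_mul (k := k)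
    (rename (Fin.natAdd a) : _ →ₐ[k] MvPolynomial (Fin (a + b)) k).toRingHom,
    Finset.prod_Ico_eq_prod_range, Nat.add_sub_cancel_left, Finset.prod_range]
  congr 1
  refine Finset.prod_congr rfl fun j _ => ?_
  rw [linFactor, dif_pos (by omega)]
  simp [Fin.natAdd]

end Series

/-! ### Cosets and shuffles -/

section Cosets

variable (k : Type u) [CommRing k]

theorem blockOf_pair (a b i : ℕ) (hi : i < a + b) :
    blockOf ([a] ++ [b]) i = if i < a then 0 else 1 := by
  simp only [List.cons_append, List.nil_append, blockOf]
  split_ifs <;> omega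

theorem mem_young_pair {a b r : ℕ} (h : a + b = r) (w : Equiv.Perm (Fin r)) :
    w ∈ young r ([a] ++ [b]) ↔ ∀ i, (w i : ℕ) < a ↔ (i : ℕ) < a := by
  refine forall_congr' fun i => ?_
  rw [blockOf_pair _ _ _ (by omega), blockOf_pair _ _ _ (by omega)]
  split_ifs <;> simp [*]

/-- A right coset of `S_a × S_b` in `S_{a+b}` is determined by the set of letters which its
elements map to the initial block, and the shuffle of that set represents it. -/
theorem cosetSum_pair {a b r : ℕ} (h : a + b = r) :
    cosetSum k r ([a] ++ [b]) =
      ∑ A ∈ (Finset.range r).powersetCard a, mvec ([a] ++ [b]) (tgen k (shuffle r r A)) := by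
  classical
  have hval : ∀ A ∈ (Finset.range r).powersetCard a, ∀ j : Fin r,
      (shuffle r r A j : ℕ) < a ↔ (j : ℕ) ∈ A := by
    intro A hA j
    have h1 := (shuffle_val_lt_iff le_rfl A j j.2).2
    rwa [Finset.filter_true_of_mem, (Finset.mem_powersetCard.1 hA).2] at h1
    exact fun x hx => by simpa using (Finset.mem_powersetCard.1 hA).1 hx
  rw [cosetSum]
  symm
  refine Finset.sum_bij (fun A _ => Quotient.mk _ (shuffle r r A)) (fun _ _ => Finset.mem_univ _)
    ?_ ?_ (fun _ _ => rfl)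
  · intro A hA A' hA' e
    have h1 := QuotientGroup.rightRel_apply.1 (Quotient.exact e)
    rw [mem_young_pair h] at h1
    ext x
    by_cases hx : x < r
    · have h2 := h1 (shuffle r r A ⟨x, hx⟩)
      rw [Equiv.Perm.mul_apply, Equiv.Perm.inv_def, Equiv.symm_apply_apply, hval A' hA',
        hval A hA] at h2
      exact h2.symm
    · have h3 : ∀ B ∈ (Finset.range r).powersetCard a, x ∉ B := fun B hB hxB =>
        hx (by simpa using (Finset.mem_powersetCard.1 hB).1 hxB)
      simp [h3 A hA, h3 A' hA']
  · intro q _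
    induction q using Quotient.inductionOn with
    | _ w =>
    -- the letters which `w` maps to the initial block
    let A : Finset ℕ := (Finset.univ.filter fun i : Fin r => (w i : ℕ) < a).map Fin.valEmbedding
    have hmem : ∀ j : Fin r, (j : ℕ) ∈ A ↔ (w j : ℕ) < a := by
      intro j
      simp only [A, Finset.mem_map, Finset.mem_filter, Finset.mem_univ, true_and,
        Fin.valEmbedding_apply]
      constructor
      · rintro ⟨i, hi, e⟩
        rwa [← Fin.ext e]
      · exact fun hj => ⟨j, hj, rfl⟩
    have hA : A ∈ (Finset.range r).powersetCard a := by
      rw [Finset.mem_powersetCard]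
      constructor
      · intro x hx
        obtain ⟨i, -, rfl⟩ := Finset.mem_map.1 hx
        simp
      · rw [Finset.card_map, Finset.card_equiv w (t := Finset.univ.filter fun i : Fin r =>
          (i : ℕ) < a) (by simp), Fin.card_filter_val_lt]
        omega
    refine ⟨A, hA, Quotient.sound (QuotientGroup.rightRel_apply.2 ?_)⟩
    rw [mem_young_pair h]
    intro i
    rw [Equiv.Perm.mul_apply, ← hmem, ← hval A hA, Equiv.Perm.inv_def, Equiv.apply_symm_apply]

end Cosets

/-! ### Split, pin and merge in terms of shuffles -/

namespace ASchur

open CategoryTheory MulOpposite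

variable {k : Type u} [CommRing k]

/-- A homomorphism out of the module attached to a composition is determined by the image of the
generator. -/
theorem affM_hom_ext {r : ℕ} {lam nu : List ℕ}
    {f g : AffM k r lam →ₗ[(AH k r)ᵐᵒᵖ] AffM k r nu} (h : f (mvec lam 1) = g (mvec lam 1)) :
    f = g := by
  refine LinearMap.ext fun v => ?_
  obtain ⟨p, rfl⟩ := Submodule.Quotient.mk_surjective _ v
  have e : (Submodule.Quotient.mk p : AffM k r lam) = op p • mvec lam 1 := by
    rw [op_smul_mvec, one_mul]; rfl
  rw [e, map_smul, map_smul, h]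

theorem homOfVec_mvec_one {r : ℕ} {lam nu : List ℕ} (v : AffM k r nu)
    (hv : ∀ w ∈ young r lam, op (tgen k w) • v = v) :
    homOfVec v hv (mvec lam 1) = v := by
  rw [homOfVec_mvec, op_one, one_smul]

theorem shiftAH_ofPoly {c a r : ℕ} (h : c + a ≤ r) (p : MvPolynomial (Fin a) k) :
    shiftAH k c a r h (ofPoly k a p) = ofPoly k r (rename (shiftEmb c a r h) p) := by
  induction p using MvPolynomial.induction_on with
  | C z => simp [MvPolynomial.algHom_C]
  | add p q hp hq => simp only [map_add, hp, hq]
  | mul_X p i hp => simp only [map_mul, hp, ofPoly_X, shiftAH_xgen, rename_X]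

theorem pin_apply_mvec_one {r : ℕ} (f : symmetricSubalgebra (Fin r) k) (s) :
    pin k r f s (mvec [r] 1) =
      mvec [r] (ofPoly k s (rename (finCongr (str_sum s.2.1)) (f : MvPolynomial (Fin r) k))) := by
  change op (1 : AH k s.1) • (mvec (k := k) [r] (ofPoly k s.1 _) : AffM k s.1 [r]) = _
  rw [op_one, one_smul]

theorem pin_mul {r : ℕ} (f g : symmetricSubalgebra (Fin r) k) :
    pin k r (f * g) = pin k r f * pin k r g := by
  funext s
  refine affM_hom_ext ?_
  have h : (pin k r f * pin k r g) s (mvec [r] 1) = (pin k r f s) (pin k r g s (mvec [r] 1)) :=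
    congrArg (fun q => q (mvec [r] 1)) (Hom.comp_pos (pin k r g) (pin k r f) s s.2.1)
  refine Eq.trans ?_ h.symm
  rw [pin_apply_mvec_one, pin_apply_mvec_one]
  change _ = op (ofPoly k s (rename _ (g : MvPolynomial (Fin r) k))) • mvec [r] _
  rw [op_smul_mvec, mul_comm f g, Subalgebra.coe_mul, map_mul, map_mul,
    ← map_mul (ofPoly k s), ← map_mul (ofPoly k s), mul_comm]

/-- Splitting, applying an endomorphism of `(a, b)` and merging. -/
theorem split_comp_merge {a b : ℕ} (p : tens (str k a) (str k b) ⟶ tens (str k a) (str k b))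
    (q : End (str k (a + b))) (c : AH k (a + b))
    (hp : p ⟨a + b, by simp, by simp⟩ (mvec ([a] ++ [b]) 1) = mvec ([a] ++ [b]) c)
    (hq : q ⟨a + b, by simp, by simp⟩ (mvec [a + b] 1) =
      mvec [a + b] (c * shuffleSum (tgen k) a (a + b))) :
    split k a b ≫ p ≫ merge k a b = q := by
  funext s
  obtain ⟨s, hs, hs'⟩ := s
  obtain rfl := str_sum hs
  have h0 : (tens (str k a) (str k b)).parts.sum = a + b := by simp
  refine affM_hom_ext ?_
  have e1 : (split k a b ≫ p ≫ merge k a b) ⟨a + b, hs, hs'⟩ =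
      (merge k a b ⟨a + b, h0, hs'⟩).comp ((p ⟨a + b, h0, h0⟩).comp
        (split k a b ⟨a + b, hs, h0⟩)) :=
    (Hom.comp_pos (split k a b) _ ⟨a + b, hs, hs'⟩ h0).trans
      (congrArg (fun q => LinearMap.comp q (split k a b ⟨a + b, hs, h0⟩))
        (Hom.comp_pos p (merge k a b) ⟨a + b, h0, hs'⟩ h0))
  have e2 : split k a b ⟨a + b, hs, h0⟩ (mvec [a + b] 1) = cosetSum k (a + b) ([a] ++ [b]) :=
    homOfVec_mvec_one _ _
  have e3 : ∀ w, merge k a b ⟨a + b, h0, hs'⟩ (p ⟨a + b, h0, h0⟩ (mvec ([a] ++ [b]) w)) =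
      mvec [a + b] (c * w) := by
    intro w
    have h1 : (mvec ([a] ++ [b]) w : AffM k (a + b) ([a] ++ [b])) =
        op w • mvec ([a] ++ [b]) 1 := by
      rw [op_smul_mvec, one_mul]
    rw [h1]
    refine (congrArg _ ((map_smul (p ⟨a + b, h0, h0⟩) (op w) _).trans
      (congrArg (fun v : AffM k (a + b) ([a] ++ [b]) => op w • v) hp))).trans ?_
    rw [op_smul_mvec]
    change op (c * w) • (mvec (k := k) [a + b] 1 : AffM k (a + b) [a + b]) = _
    rw [op_smul_mvec, one_mul]
  refine (congrArg (fun q => q (mvec [a + b] 1)) e1).trans ?_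
  refine Eq.trans ?_ hq.symm
  change merge k a b ⟨a + b, h0, hs'⟩ (p ⟨a + b, h0, h0⟩
    (split k a b ⟨a + b, hs, h0⟩ (mvec [a + b] 1))) = _
  rw [e2, cosetSum_pair k rfl]
  rw [map_sum, map_sum, shuffleSum, Finset.mul_sum]
  refine (Finset.sum_congr rfl fun A _ => e3 _).trans ?_
  exact (map_sum ((trivIdeal k (a + b) [a + b]).mkQ.toAddMonoidHom)
    (fun A => c * tgen k (shuffle (a + b) (a + b) A)) _).symm

theorem tensHom_mvec_one {a b : ℕ} (f : End (str k a)) (g : End (str k b))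
    (P : MvPolynomial (Fin [a].sum) k) (Q : MvPolynomial (Fin [b].sum) k)
    (hf : f ⟨[a].sum, rfl, rfl⟩ (mvec [a] 1) = mvec [a] (ofPoly k _ P))
    (hg : g ⟨[b].sum, rfl, rfl⟩ (mvec [b] 1) = mvec [b] (ofPoly k _ Q)) :
    tensHom (X := str k a) (Y := str k a) (X' := str k b) (Y' := str k b) f g
        ⟨a + b, by simp, by simp⟩ (mvec ([a] ++ [b]) 1) =
      mvec ([a] ++ [b]) (ofPoly k (a + b)
        (rename (shiftEmb 0 [a].sum (a + b) (by simp)) P *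
          rename (shiftEmb [a].sum [b].sum (a + b) (by simp)) Q)) := by
  have hsum : [a].sum + [b].sum = a + b := by simp
  have e : tensHom (X := str k a) (Y := str k a) (X' := str k b) (Y' := str k b) f g
      ⟨a + b, by simp, by simp⟩ (mvec ([a] ++ [b]) 1) =
      juxt hsum [a] [b] rfl (f ⟨[a].sum, rfl, rfl⟩ (mvec [a] 1))
        (g ⟨[b].sum, rfl, rfl⟩ (mvec [b] 1)) := by
    unfold tensHom
    rw [dif_pos rfl]
    exact homOfVec_mvec_one _ _
  rw [e, hf, hg, juxt_mvec, shiftAH_ofPoly, shiftAH_ofPoly, map_mul]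

theorem id_mvec_one (r s) :
    (𝟙 (str k r) : End (str k r)) s (mvec [r] 1) = mvec [r] (ofPoly k s 1) := by
  rw [map_one]; rfl

theorem pin_self_mvec_one {r : ℕ} (f : symmetricSubalgebra (Fin r) k) :
    pin k r f ⟨r, by simp, by simp⟩ (mvec [r] 1) = mvec [r] (ofPoly k r f) := by
  rw [pin_apply_mvec_one]
  congr 2
  exact rename_id_apply _

/-- A pin on the left string of a bubble is a pin on the whole string as soon as this holds in the
module attached to `(a + b)`. -/
theorem bubbleLeft_pin {a b : ℕ} (f : symmetricSubalgebra (Fin a) k)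
    (g : symmetricSubalgebra (Fin (a + b)) k)
    (h : mvec [a + b] (ofPoly k (a + b) (rename (Fin.castAdd b) (f : MvPolynomial (Fin a) k)) *
      shuffleSum (tgen k) a (a + b)) = mvec [a + b] (ofPoly k (a + b) g)) :
    bubbleLeft k a b (pin k a f) = pin k (a + b) g := by
  refine split_comp_merge _ _ _
    (tensHom_mvec_one _ _ _ _ (pin_apply_mvec_one f _) (id_mvec_one b _)) ?_
  have e : shiftEmb 0 [a].sum (a + b) (by simp) ∘ finCongr (by simp) = Fin.castAdd b :=
    funext fun j => Fin.ext (Nat.zero_add (j : ℕ))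
  rw [pin_self_mvec_one, ← h, map_one, mul_one, rename_rename, e]

/-- A pin on the right string of a bubble is a pin on the whole string as soon as this holds in the
module attached to `(a + b)`. -/
theorem bubbleRight_pin {a b : ℕ} (f : symmetricSubalgebra (Fin b) k)
    (g : symmetricSubalgebra (Fin (a + b)) k)
    (h : mvec [a + b] (ofPoly k (a + b) (rename (Fin.natAdd a) (f : MvPolynomial (Fin b) k)) *
      shuffleSum (tgen k) a (a + b)) = mvec [a + b] (ofPoly k (a + b) g)) :
    bubbleRight k a b (pin k b f) = pin k (a + b) g := by
  refine split_comp_merge _ _ _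
    (tensHom_mvec_one _ _ _ _ (id_mvec_one a _) (pin_apply_mvec_one f _)) ?_
  have e : shiftEmb [a].sum [b].sum (a + b) (by simp) ∘ finCongr (by simp) = Fin.natAdd a :=
    funext fun j => Fin.ext (by change [a].sum + (j : ℕ) = a + j; simp)
  rw [pin_self_mvec_one, ← h, map_one, one_mul, rename_rename, e]

/-- Pins multiply like symmetric polynomials. -/
theorem pinSeries_mul (r : ℕ) (F G : LaurentSeries (symmetricSubalgebra (Fin r) k)) :
    pinSeries k r (F * G) = pinSeries k r F * pinSeries k r G :=
  HahnSeries.map_mul ({ pin k r with map_mul' := pin_mul, map_zero' := map_zero (pin k r) } :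
    symmetricSubalgebra (Fin r) k →ₙ+* End (str k r))

variable (k) in
/-- `pinSeries` as an additive map. -/
noncomputable def pinSeriesHom (r : ℕ) :
    LaurentSeries (symmetricSubalgebra (Fin r) k) →+ LaurentSeries (End (str k r)) where
  toFun := pinSeries k r
  map_zero' := HahnSeries.map_zero (pin k r).toZeroHom
  map_add' _ _ := HahnSeries.map_add (pin k r)

theorem pinSeriesHom_apply (r : ℕ) (F : LaurentSeries (symmetricSubalgebra (Fin r) k)) :
    pinSeriesHom k r F = pinSeries k r F := rfl

end ASchur

/-! ### Integral coefficients and base change -/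

section Integral

theorem laurentSeries_nsmul_right_injective {A : Type*} [AddCommGroup A] [IsAddTorsionFree A]
    {m : ℕ} (hm : m ≠ 0) : Function.Injective fun F : LaurentSeries A => m • F := by
  intro F G h
  ext j
  exact nsmul_right_injective hm (congrArg (fun F => HahnSeries.coeff F j) h)

variable (k : Type u) [CommRing k] (n : ℕ)

/-- Forgetting that the coefficients of a Laurent series are symmetric polynomials. -/
noncomputable abbrev symForget :
    LaurentSeries (symmetricSubalgebra (Fin n) k) →+* LaurentSeries (MvPolynomial (Fin n) k) :=
  mapCoeff (symmetricSubalgebra (Fin n) k).val.toRingHom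

theorem symForget_injective : Function.Injective (symForget k n) := by
  intro F G h
  refine HahnSeries.ext (funext fun j => ?_)
  exact Subtype.ext (congrArg (fun F => HahnSeries.coeff F j) h)

theorem mapCoeff_map_elemPoly (c : ℤ) :
    mapCoeff (map (Int.castRingHom k)) (elemPoly ℤ n c) = elemPoly k n c := by
  rw [elemPoly, elemPoly, map_prod]
  refine Finset.prod_congr rfl fun j _ => ?_
  rw [map_sub, map_add, map_intCast, HahnSeries.C_apply, HahnSeries.C_apply, mapCoeff_single,
    mapCoeff_single, map_one (map (Int.castRingHom k)), map_X]

theorem mapCoeff_map_compPoly :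
    mapCoeff (map (Int.castRingHom k)) (compPoly ℤ n) = compPoly k n := by
  refine (isUnit_elemPoly k n 0).mul_left_cancel ?_
  rw [elemPoly_mul_compPoly, ← mapCoeff_map_elemPoly, ← map_mul, elemPoly_mul_compPoly, map_one]

theorem mapCoeff_map_linFactor (j : ℕ) :
    mapCoeff (map (Int.castRingHom k)) (linFactor ℤ n j) = linFactor k n j := by
  unfold linFactor
  split_ifs
  · rw [map_sub, HahnSeries.C_apply, HahnSeries.C_apply, mapCoeff_single,
      mapCoeff_single, map_one (map (Int.castRingHom k)), map_X]
  · exact map_zero _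

theorem symForget_baseChange (F : LaurentSeries (symmetricSubalgebra (Fin n) ℤ)) :
    symForget k n (mapCoeff (baseChange k n) F) =
      mapCoeff (map (Int.castRingHom k)) (symForget ℤ n F) := rfl

theorem baseChange_elemGen (c : ℤ) :
    mapCoeff (baseChange k n) (elemGen ℤ n c) = elemGen k n c := by
  apply symForget_injective
  rw [symForget_baseChange, mapCoeff_val_elemGen, mapCoeff_val_elemGen, mapCoeff_map_elemPoly]

theorem baseChange_compGen : mapCoeff (baseChange k n) (compGen ℤ n) = compGen k n := by
  apply symForget_injective
  rw [symForget_baseChange, mapCoeff_val_compGen, mapCoeff_val_compGen, mapCoeff_map_compPoly]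

variable {k n}

/-- If `m D` is an integral combination of the series `e_n(u + d_i) h_n(u)` over the integers and a
series `L` of endomorphisms is the pin carrying the base change of `D`, then `L` satisfies all parts
of the corresponding divided identity. The coefficients of `D` are symmetric because `m` is not a
zero divisor. -/
theorem divided_identity {m : ℕ} (hm : m ≠ 0) (s : Finset ℕ) (c d : ℕ → ℤ)
    (D : LaurentSeries (MvPolynomial (Fin n) ℤ))
    (hD : m • D = ∑ i ∈ s, c i • (elemPoly ℤ n (d i) * compPoly ℤ n))
    (L : LaurentSeries (CategoryTheory.End (str k n)))
    (hL : ∀ G : LaurentSeries (symmetricSubalgebra (Fin n) k),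
      symForget k n G = mapCoeff (map (Int.castRingHom k)) D → L = pinSeries k n G) :
    (m • L = ∑ i ∈ s, c i • twoPins k n (d i)) ∧
    (∃! G : LaurentSeries (symmetricSubalgebra (Fin n) ℤ),
      m • G = ∑ i ∈ s, c i • (elemGen ℤ n (d i) * compGen ℤ n)) ∧
    (∀ G : LaurentSeries (symmetricSubalgebra (Fin n) ℤ),
      m • G = ∑ i ∈ s, c i • (elemGen ℤ n (d i) * compGen ℤ n) →
      L = pinSeries k n (mapCoeff (baseChange k n) G)) := by
  have hsum : symForget ℤ n (∑ i ∈ s, c i • (elemGen ℤ n (d i) * compGen ℤ n)) = m • D := by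
    rw [hD, map_sum]
    exact Finset.sum_congr rfl fun i _ => by
      rw [map_zsmul, map_mul, mapCoeff_val_elemGen, mapCoeff_val_compGen]
  have hiff : ∀ G : LaurentSeries (symmetricSubalgebra (Fin n) ℤ),
      m • G = ∑ i ∈ s, c i • (elemGen ℤ n (d i) * compGen ℤ n) ↔ symForget ℤ n G = D := by
    intro G
    rw [← (symForget_injective ℤ n).eq_iff, hsum, map_nsmul]
    exact (laurentSeries_nsmul_right_injective hm).eq_iff
  have hsymm : ∀ e : Equiv.Perm (Fin n),
      mapCoeff (rename e : MvPolynomial (Fin n) ℤ →ₐ[ℤ] MvPolynomial (Fin n) ℤ).toRingHom D =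
        D := by
    intro e
    -- `m D` is visibly symmetric
    apply laurentSeries_nsmul_right_injective hm
    dsimp only
    rw [← map_nsmul, hD, map_sum]
    refine Finset.sum_congr rfl fun i _ => ?_
    rw [map_zsmul, map_mul, mapCoeff_rename_elemPoly, mapCoeff_rename_compPoly]
  have hG : symForget ℤ n (symLift D hsymm) = D := rfl
  have hpin : ∀ G : LaurentSeries (symmetricSubalgebra (Fin n) ℤ),
      m • G = ∑ i ∈ s, c i • (elemGen ℤ n (d i) * compGen ℤ n) →
      L = pinSeries k n (mapCoeff (baseChange k n) G) := by
    intro G h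
    exact hL _ (by rw [symForget_baseChange, (hiff G).1 h])
  refine ⟨?_, ⟨symLift D hsymm, (hiff _).2 hG, fun G h => ?_⟩, hpin⟩
  · rw [hpin _ ((hiff _).2 hG), ← pinSeriesHom_apply, ← map_nsmul, ← map_nsmul, (hiff _).2 hG,
      map_sum, map_sum]
    refine Finset.sum_congr rfl fun i _ => ?_
    rw [map_zsmul, map_zsmul, map_mul, baseChange_elemGen, baseChange_compGen, pinSeriesHom_apply,
      pinSeries_mul]
    rfl
  · exact symForget_injective ℤ n (((hiff G).1 h).trans hG.symm)

theorem factorial_smul_fwdDiffProd_mul (a : ℕ) :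
    a.factorial • (fwdDiffProd a n (linFactor ℤ n) * compPoly ℤ n) =
      ∑ i ∈ Finset.range (a + 1), ((-1) ^ (a - i) * (a.choose i : ℤ)) •
        (elemPoly ℤ n (i : ℤ) * compPoly ℤ n) := by
  rw [nsmul_eq_mul, ← mul_assoc, factorial_mul_fwdDiffProd, Finset.sum_mul]
  refine Finset.sum_congr rfl fun i _ => ?_
  rw [← prod_linFactor_add, zsmul_eq_mul]
  push_cast
  ring

theorem factorial_smul_bwdDiffProd_mul (b : ℕ) :
    b.factorial • (bwdDiffProd (linFactor ℤ n) b n * compPoly ℤ n) =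
      ∑ i ∈ Finset.range (b + 1), ((-1) ^ i * (b.choose i : ℤ)) •
        (elemPoly ℤ n (-(i : ℤ)) * compPoly ℤ n) := by
  rw [nsmul_eq_mul, ← mul_assoc, factorial_mul_bwdDiffProd, Finset.sum_mul]
  refine Finset.sum_congr rfl fun i _ => ?_
  rw [← prod_linFactor_add, zsmul_eq_mul]
  push_cast
  simp only [sub_eq_add_neg]
  ring

theorem leftPinned_eq_pinSeries {a b : ℕ}
    (G : LaurentSeries (symmetricSubalgebra (Fin (a + b)) k))
    (hG : symForget k (a + b) G =
      fwdDiffProd a (a + b) (linFactor k (a + b)) * compPoly k (a + b)) :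
    leftPinned k a b = pinSeries k (a + b) G := by
  refine HahnSeries.ext (funext fun m => ?_)
  refine bubbleLeft_pin _ _ ?_
  refine (mvec_mul_shuffleSum_fwd (by omega) _ (mapCoeff_castAdd_compPoly_mul a b) m).trans ?_
  rw [← hG]
  rfl

theorem rightPinned_eq_pinSeries {a b : ℕ}
    (G : LaurentSeries (symmetricSubalgebra (Fin (a + b)) k))
    (hG : symForget k (a + b) G =
      bwdDiffProd (linFactor k (a + b)) b (a + b) * compPoly k (a + b)) :
    rightPinned k a b = pinSeries k (a + b) G := by
  refine HahnSeries.ext (funext fun m => ?_)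
  refine bubbleRight_pin _ _ ?_
  refine (mvec_mul_shuffleSum_bwd rfl _ (mapCoeff_natAdd_compPoly_mul a b) m).trans ?_
  rw [← hG]
  rfl

end Integral

end DegAffSchur

/-- Below, `x_1, x_2, …` are the polynomial generators, `u` is a formal variable, and all identities
are identities of formal Laurent series in `u⁻¹`. Division by a factorial has an integral meaning:
the sum has coefficients that are divisible by the factorial over `ℤ`, and the quotient is then
base changed to `k`. -/
theorem theorem5p8 (k : Type u) [CommRing k] (a b : ℕ) :
    ((a.factorial • leftPinned k a b =
        ∑ i ∈ Finset.range (a + 1),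
          ((-1) ^ (a - i) * (a.choose i : ℤ)) • twoPins k (a + b) (i : ℤ)) ∧
      (∃! G : LaurentSeries (symmetricSubalgebra (Fin (a + b)) ℤ),
        a.factorial • G = ∑ i ∈ Finset.range (a + 1),
          ((-1) ^ (a - i) * (a.choose i : ℤ)) •
            (elemGen ℤ (a + b) (i : ℤ) * compGen ℤ (a + b))) ∧
      (∀ G : LaurentSeries (symmetricSubalgebra (Fin (a + b)) ℤ),
        a.factorial • G = ∑ i ∈ Finset.range (a + 1),
          ((-1) ^ (a - i) * (a.choose i : ℤ)) •
            (elemGen ℤ (a + b) (i : ℤ) * compGen ℤ (a + b)) →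
        leftPinned k a b = pinSeries k (a + b) (mapCoeff (baseChange k (a + b)) G))) ∧
    ((b.factorial • rightPinned k a b =
        ∑ i ∈ Finset.range (b + 1),
          ((-1) ^ i * (b.choose i : ℤ)) • twoPins k (a + b) (-(i : ℤ))) ∧
      (∃! G : LaurentSeries (symmetricSubalgebra (Fin (a + b)) ℤ),
        b.factorial • G = ∑ i ∈ Finset.range (b + 1),
          ((-1) ^ i * (b.choose i : ℤ)) •
            (elemGen ℤ (a + b) (-(i : ℤ)) * compGen ℤ (a + b))) ∧
      (∀ G : LaurentSeries (symmetricSubalgebra (Fin (a + b)) ℤ),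
        b.factorial • G = ∑ i ∈ Finset.range (b + 1),
          ((-1) ^ i * (b.choose i : ℤ)) •
            (elemGen ℤ (a + b) (-(i : ℤ)) * compGen ℤ (a + b)) →
        rightPinned k a b = pinSeries k (a + b) (mapCoeff (baseChange k (a + b)) G))) := by
  constructor
  · refine divided_identity a.factorial_ne_zero _ _ _ _ (factorial_smul_fwdDiffProd_mul a) _
      fun G hG => leftPinned_eq_pinSeries G (hG.trans ?_)
    rw [map_mul, map_fwdDiffProd, mapCoeff_map_compPoly]
    simp only [mapCoeff_map_linFactor]
  · refine divided_identity b.factorial_ne_zero _ _ _ _ (factorial_smul_bwdDiffProd_mul b) _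
      fun G hG => rightPinned_eq_pinSeries G (hG.trans ?_)
    rw [map_mul, map_bwdDiffProd, mapCoeff_map_compPoly]
    simp only [mapCoeff_map_linFactor]
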